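/- Let $r\ge 2$ and $n,d\ge 1$. For a matrix $V$, $\mathrm{conv}(V)$ denotes the convex hull of its rows, $\sigma_{\max}(V)$ and $\sigma_{\min}(V)$ its largest and its smallest nonzero singular value, and $\kappa(V)=\sigma_{\max}(V)/\sigma_{\min}(V)$. Let $\Delta^m=\{\pi\in\mathbb{R}^m_{\ge0}:\sum_i\pi_i=1\}$. For $u\in\mathbb{R}^d$, $V\in\mathbb{R}^{m\times d}$ and $U\in\mathbb{R}^{k\times d}$ with rows $u_1,\dots,u_k$ put $\mathscr{D}(u;V)=\min_{\pi\in\Delta^m}\|u-V^{\mathsf T}\pi\|_2^2$ and $\mathscr{D}(U;V)=\sum_{\ell\le k}\mathscr{D}(u_\ell;V)$. For $H_0,H\in\mathbb{R}^{r\times d}$ with rows $h_{0,\ell}$, $h_{\ell}$ put $\mathscr{L}(H_0,H)=\sum_{\ell\le r}\min_{\ell'\le r}\|h_{0,\ell}-h_{\ell'}\|_2^2$. Let $X=X_0+Z\in\mathbb{R}^{n\times d}$ with $X_0=W_0H_0$, where the rows of $W_0\in\mathbb{R}^{n\times r}$ lie in $\Delta^r$ and $H_0\in\mathbb{R}^{r\times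 d}$ has linearly independent rows, and let $\delta=\max_{i\le n}\|Z_{i,\cdot}\|_2$. Let $\alpha>0$ and assume that the factorization is $\alpha$-unique: for all $H\in\mathbb{R}^{r\times d}$ with $\mathrm{conv}(X_0)\subseteq\mathrm{conv}(H)$, $$\mathscr{D}(H;X_0)^{1/2}\ge\mathscr{D}(H_0;X_0)^{1/2}+\alpha\big\{\mathscr{D}(H;H_0)^{1/2}+\mathscr{D}(H_0;H)^{1/2}\big\}.$$ Let $\mu>0$ and assume that $\mathrm{conv}(X_0)$ contains an $(r-1)$-dimensional ball of radius $\mu$ centred at $z_0\in\mathbb{R}^d$: there is $U\in\mathbb{R}^{d\times(r-1)}$ with $U^{\mathsf T}U=I_{r-1}$ and $z_0+Uv\in\mathrm{conv}(X_0)$ whenever $\|v\|_2\le\mu$. Let $\widehat H$ be any minimizer of $\mathscr{D}(H;X)$ over the $H\in\mathbb{R}^{r\times d}$ that satisfy $\mathscr{D}(x_i;H)\le\delta^2$ for every row $x_i$ of $X$. (1) If $\delta\le\dfrac{\alpha\mu}{30\,r^{3/2}}$, then $\mathscr{L}(H_0,\widehat H)\le\dfrac{C_*^2r^5}{\alpha^2}\,\delta^2$,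 where $C_*=120\,\dfrac{\sigma_{\max}(H_0)}{\mu}\,\max\Big(1,\dfrac{\kappa(H_0)}{\sqrt r}\Big)$. (2) If $\delta\le\dfrac{\alpha\mu}{330\,\kappa(H_0)\,r^{5/2}}$, then $\mathscr{L}(H_0,\widehat H)\le\dfrac{C_{**}^2r^4}{\alpha^2}\,\delta^2$, where $C_{**}=120\,\max\Big(\kappa(H_0),\dfrac{\sigma_{\max}(H_0)/r+\|z_0\|_2}{\mu\sqrt r}\Big)\max\Big(1,\dfrac{\kappa(H_0)}{\sqrt r}\Big)$. -/

import Mathlib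

open Set

/-!
A real `m × d` matrix is represented by the family of its rows
`V : Fin m → EuclideanSpace ℝ (Fin d)`; the norm of a row is the Euclidean norm.
-/

noncomputable section

namespace Archetypes

/-- The convex hull of the rows of a matrix. -/
def rowHull {m d : ℕ} (V : Fin m → EuclideanSpace ℝ (Fin d)) :
    Set (EuclideanSpace ℝ (Fin d)) :=
  convexHull ℝ (range V)

/-- `𝓓(u; V)` for the square loss: the minimum over `π` in the standard simplex of
`‖u - Vᵀ π‖²`. -/
def distSq {m d : ℕ} (u : EuclideanSpace ℝ (Fin d)) (V : Fin m → EuclideanSpace ℝ (Fin d)) : ℝ :=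
  sInf ((fun p : Fin m → ℝ => ‖u - ∑ i, p i • V i‖ ^ 2) '' stdSimplex ℝ (Fin m))

/-- `𝓓(U; V)`: the sum of `𝓓(u; V)` over the rows `u` of `U`. -/
def sumDistSq {k m d : ℕ} (U : Fin k → EuclideanSpace ℝ (Fin d))
    (V : Fin m → EuclideanSpace ℝ (Fin d)) : ℝ :=
  ∑ l, distSq (U l) V

/-- The estimation error `𝓛(H₀, H)`: the sum over the rows of `H₀` of the squared distance to the
closest row of `H`. -/
def archetypeLoss {r d : ℕ} (H₀ H : Fin r → EuclideanSpace ℝ (Fin d)) : ℝ :=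
  ∑ l, ⨅ l', ‖H₀ l - H l'‖ ^ 2

/-- The product `W H` of a weight matrix and an archetype matrix, as a family of rows. -/
def weightedRows {n r d : ℕ} (W : Matrix (Fin n) (Fin r) ℝ)
    (H : Fin r → EuclideanSpace ℝ (Fin d)) : Fin n → EuclideanSpace ℝ (Fin d) :=
  fun i => ∑ l, W i l • H l

/-- The largest norm of a row. -/
def maxRowNorm {n d : ℕ} (Z : Fin n → EuclideanSpace ℝ (Fin d)) : ℝ :=
  ⨆ i, ‖Z i‖

/-- Uniqueness with parameter `α` of a factorization with data rows `X₀` and archetypes `H₀`. -/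
def IsUniqueWith {n r d : ℕ} (α : ℝ) (X₀ : Fin n → EuclideanSpace ℝ (Fin d))
    (H₀ : Fin r → EuclideanSpace ℝ (Fin d)) : Prop :=
  ∀ H : Fin r → EuclideanSpace ℝ (Fin d), rowHull X₀ ⊆ rowHull H →
    √(sumDistSq H₀ X₀) + α * (√(sumDistSq H H₀) + √(sumDistSq H₀ H)) ≤ √(sumDistSq H X₀)

/-- The convex hull of the rows of `X₀` contains a `k`-dimensional ball with centre `z₀` and
radius `μ`. -/
def ContainsBall {n d : ℕ} (k : ℕ) (X₀ : Fin n → EuclideanSpace ℝ (Fin d))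
    (z₀ : EuclideanSpace ℝ (Fin d)) (μ : ℝ) : Prop :=
  ∃ U : EuclideanSpace ℝ (Fin k) →ₗᵢ[ℝ] EuclideanSpace ℝ (Fin d),
    ∀ v : EuclideanSpace ℝ (Fin k), ‖v‖ ≤ μ → z₀ + U v ∈ rowHull X₀

/-- `H` is feasible for the hard-constrained problem: every data row is within `δ` of the convex
hull of the rows of `H`. -/
def IsFeasible {n r d : ℕ} (δ : ℝ) (X : Fin n → EuclideanSpace ℝ (Fin d))
    (H : Fin r → EuclideanSpace ℝ (Fin d)) : Prop :=
  ∀ i, distSq (X i) H ≤ δ ^ 2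

/-- `H` is a solution of the problem: minimize `𝓓(H; X)` subject to
`𝓓(xᵢ; H) ≤ δ²` for all `i`. -/
def IsEstimator {n r d : ℕ} (δ : ℝ) (X : Fin n → EuclideanSpace ℝ (Fin d))
    (H : Fin r → EuclideanSpace ℝ (Fin d)) : Prop :=
  IsFeasible δ X H ∧
    ∀ H' : Fin r → EuclideanSpace ℝ (Fin d), IsFeasible δ X H' → sumDistSq H X ≤ sumDistSq H' X

/-- The linear map `a ↦ Hᵀ a`; its nonzero singular values are those of the matrix `H`. -/
def transposeMap {r d : ℕ} (H : Fin r → EuclideanSpace ℝ (Fin d)) :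
    EuclideanSpace ℝ (Fin r) →ₗ[ℝ] EuclideanSpace ℝ (Fin d) :=
  (Fintype.linearCombination ℝ H) ∘ₗ (WithLp.linearEquiv 2 ℝ (Fin r → ℝ)).toLinearMap

/-- The largest singular value of `H` (Mathlib lists singular values in decreasing order,
starting at index `0`). -/
def sigmaMax {r d : ℕ} (H : Fin r → EuclideanSpace ℝ (Fin d)) : ℝ :=
  (transposeMap H).singularValues 0

/-- The smallest nonzero singular value of `H`. -/
def sigmaMin {r d : ℕ} (H : Fin r → EuclideanSpace ℝ (Fin d)) : ℝ :=
  sInf {s : ℝ | s ≠ 0 ∧ ∃ i : ℕ, (transposeMap H).singularValues i = s}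

/-- The condition number of `H`. -/
def condNumber {r d : ℕ} (H : Fin r → EuclideanSpace ℝ (Fin d)) : ℝ :=
  sigmaMax H / sigmaMin H

/-- The coefficient `C_*`. -/
def coeffOne {r d : ℕ} (H₀ : Fin r → EuclideanSpace ℝ (Fin d)) (μ : ℝ) : ℝ :=
  120 * (sigmaMax H₀ / μ) * max 1 (condNumber H₀ / √r)

/-- The coefficient `C_**`. -/
def coeffTwo {r d : ℕ} (H₀ : Fin r → EuclideanSpace ℝ (Fin d))
    (z₀ : EuclideanSpace ℝ (Fin d)) (μ : ℝ) : ℝ :=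
  120 * max (condNumber H₀) ((sigmaMax H₀ / r + ‖z₀‖) / (μ * √r)) * max 1 (condNumber H₀ / √r)

end Archetypes

end

/-! Uniqueness speaks only about simplices that cover `X₀`, while the estimator covers it only up to
`2 * δ`. The remedy is to modify the estimator until it covers, and to pay for the modification.

First `Hhat` is projected orthogonally onto the affine hull of `H₀`, giving `V`
(`exists_projection`). The data stay within `2 * δ` of conv(V), so separation shows that conv(V)
contains the ball about `z₀` of radius `μ - 2 * δ` (`add_mem_of_forall_exists_near`). Expanding `V`
about the centre of a ball of radius `ρ` by the factor `1 + 2 * δ / ρ` gives `H` covering `X₀`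
(`IsUniqueWith.bound_of_near`). As `H₀` is feasible, the objective at `Hhat` exceeds that at `H₀` by
only `O(√r δ)`, and uniqueness bounds `α * (a + b)`, where `a` and `b` are the distances between the
simplices of `H` and `H₀`.

Close simplices have close vertices: an archetype that is nearly a mixture of points of conv(H₀)
must have one of these points near it (`exists_vertex_selection`). The return from `V` to `Hhat`
uses the affine map from the rows of `V` to the normal displacements. It is small at points near the
whole ball, hence has small slope (`exists_slope_bound`).

For the second bound, the expansion should cost `δ * κ` instead of `δ * S / μ`. If `s / r ≤ μ`, this
is immediate. Otherwise the first pass only localizes: conv(H₀) contains a ball of radius `s / r`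
about its centroid, conv(V) is close enough to contain most of it, and expanding about the centroid
gives the sharper estimate. Smallness of `a + b` also improves the vertex selection, replacing a
factor `√r` by `√2`. -/

namespace Archetypes

/-! ### Frobenius norms of families of rows -/

section Frobenius

variable {k : ℕ} {E F : Type*} [NormedAddCommGroup E] [NormedAddCommGroup F]

/-- The Frobenius norm of a matrix given by its rows. -/
noncomputable def frobNorm (A : Fin k → E) : ℝ := √(∑ l, ‖A l‖ ^ 2)

theorem frobNorm_eq_norm (A : Fin k → E) :
    frobNorm A = ‖(WithLp.toLp 2 A : PiLp 2 (fun _ : Fin k => E))‖ := by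
  rw [PiLp.norm_eq_of_L2, frobNorm]

theorem frobNorm_nonneg (A : Fin k → E) : 0 ≤ frobNorm A := Real.sqrt_nonneg _

theorem sq_frobNorm (A : Fin k → E) : frobNorm A ^ 2 = ∑ l, ‖A l‖ ^ 2 :=
  Real.sq_sqrt (by positivity)

theorem frobNorm_add_le (A B : Fin k → E) : frobNorm (A + B) ≤ frobNorm A + frobNorm B := by
  simp only [frobNorm_eq_norm, WithLp.toLp_add]
  exact norm_add_le _ _

theorem frobNorm_smul [NormedSpace ℝ E] (c : ℝ) (A : Fin k → E) : frobNorm (c • A) =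
    |c| * frobNorm A := by
  simp only [frobNorm_eq_norm, WithLp.toLp_smul, norm_smul, Real.norm_eq_abs]

theorem frobNorm_smul_of_nonneg [NormedSpace ℝ E] {c : ℝ} (hc : 0 ≤ c) (A : Fin k → E) :
    frobNorm (c • A) = c * frobNorm A := by
  rw [frobNorm_smul, abs_of_nonneg hc]

theorem frobNorm_mono {A : Fin k → E} {B : Fin k → F} (h : ∀ l, ‖A l‖ ≤ ‖B l‖) :
    frobNorm A ≤ frobNorm B :=
  Real.sqrt_le_sqrt (Finset.sum_le_sum fun l _ => pow_le_pow_left₀ (norm_nonneg _) (h l) 2)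

theorem frobNorm_const (c : E) : frobNorm (fun _ : Fin k => c) = √k * ‖c‖ := by
  simp [frobNorm, Real.sqrt_mul, Real.sqrt_sq]

theorem frobNorm_le_of_forall_le {A : Fin k → E} {c : ℝ} (h : ∀ l, ‖A l‖ ≤ c) (hc : 0 ≤ c) :
    frobNorm A ≤ √k * c := by
  have := frobNorm_mono (A := A) (B := fun _ => c)
    (fun l => (h l).trans (le_abs_self c))
  rwa [frobNorm_const, Real.norm_of_nonneg hc] at this

theorem norm_le_frobNorm (A : Fin k → E) (l : Fin k) : ‖A l‖ ≤ frobNorm A :=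
  Real.le_sqrt_of_sq_le
    (Finset.single_le_sum (f := fun l => ‖A l‖ ^ 2) (fun _ _ => by positivity) (Finset.mem_univ l))

theorem frobNorm_norm (A : Fin k → E) : frobNorm (fun l => ‖A l‖) = frobNorm A := by
  simp [frobNorm]

theorem frobNorm_le_add {F' : Type*} [NormedAddCommGroup F']
    {A : Fin k → E} {B : Fin k → F} {C : Fin k → F'}
    (h : ∀ l, ‖A l‖ ≤ ‖B l‖ + ‖C l‖) : frobNorm A ≤ frobNorm B + frobNorm C := by
  rw [← frobNorm_norm B, ← frobNorm_norm C]
  refine le_trans (frobNorm_mono fun l => ?_) (frobNorm_add_le _ _)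
  exact (h l).trans (le_abs_self _)

theorem frobNorm_sub_le_add (A B C : Fin k → E) :
    frobNorm (A - C) ≤ frobNorm (A - B) + frobNorm (B - C) :=
  frobNorm_le_add fun l => norm_sub_le_norm_sub_add_norm_sub (A l) (B l) (C l)

theorem sum_norm_le_sqrt_mul_frobNorm (A : Fin k → E) : ∑ l, ‖A l‖ ≤ √k * frobNorm A := by
  have h := Finset.sum_mul_sq_le_sq_mul_sq Finset.univ (fun _ : Fin k => (1 : ℝ)) (fun l => ‖A l‖)
  simp only [one_mul, one_pow, Finset.sum_const, Finset.card_univ, Fintype.card_fin,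
    nsmul_eq_mul, mul_one] at h
  rw [frobNorm, ← Real.sqrt_mul (by positivity)]
  exact Real.le_sqrt_of_sq_le h

end Frobenius

/-! ### Convex hulls and distances to them -/

section Hull

variable {k m d : ℕ}

theorem mem_convexHull_range_iff {E : Type*} [AddCommGroup E] [Module ℝ E] {V : Fin m → E}
    {x : E} : x ∈ convexHull ℝ (range V) ↔ ∃ p ∈ stdSimplex ℝ (Fin m), ∑ i, p i • V i = x := by
  classical
  have h : (Fintype.linearCombination ℝ V) '' stdSimplex ℝ (Fin m) = convexHull ℝ (range V) := by
    rw [← convexHull_rangle_single_eq_stdSimplex, LinearMap.image_convexHull, ← Set.range_comp]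
    congr 2
    ext i
    simp [Fintype.linearCombination_apply]
  rw [← h]
  rfl

theorem mem_rowHull_iff {V : Fin m → EuclideanSpace ℝ (Fin d)} {x : EuclideanSpace ℝ (Fin d)} :
    x ∈ rowHull V ↔ ∃ p ∈ stdSimplex ℝ (Fin m), ∑ i, p i • V i = x :=
  mem_convexHull_range_iff

theorem mem_rowHull_self (V : Fin m → EuclideanSpace ℝ (Fin d)) (i : Fin m) : V i ∈ rowHull V :=
  subset_convexHull ℝ _ (mem_range_self i)

theorem convex_rowHull (V : Fin m → EuclideanSpace ℝ (Fin d)) : Convex ℝ (rowHull V) :=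
  convex_convexHull ℝ _

theorem rowHull_subset {V : Fin m → EuclideanSpace ℝ (Fin d)} {C : Set (EuclideanSpace ℝ (Fin d))}
    (hC : Convex ℝ C) (h : ∀ i, V i ∈ C) :
    rowHull V ⊆ C :=
  convexHull_min (range_subset_iff.2 h) hC

theorem sub_mem_of_mem_rowHull {V : Fin m → EuclideanSpace ℝ (Fin d)}
    {K : Submodule ℝ (EuclideanSpace ℝ (Fin d))} {z x : EuclideanSpace ℝ (Fin d)}
    (hV : ∀ i, V i - z ∈ K) (hx : x ∈ rowHull V) : x - z ∈ K := by
  obtain ⟨p, hp, rfl⟩ := mem_rowHull_iff.1 hx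
  have h : ∑ i, p i • V i - z = ∑ i, p i • (V i - z) := by
    simp [smul_sub, Finset.sum_sub_distrib, ← Finset.sum_smul, hp.2]
  rw [h]
  exact Submodule.sum_mem _ fun i _ => Submodule.smul_mem _ _ (hV i)

theorem isCompact_rowHull (V : Fin m → EuclideanSpace ℝ (Fin d)) : IsCompact (rowHull V) :=
  (finite_range V).isCompact_convexHull ℝ

theorem distSq_le {V : Fin m → EuclideanSpace ℝ (Fin d)} (u : EuclideanSpace ℝ (Fin d))
    {y : EuclideanSpace ℝ (Fin d)} (hy : y ∈ rowHull V) :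
    distSq u V ≤ ‖u - y‖ ^ 2 := by
  obtain ⟨p, hp, rfl⟩ := mem_rowHull_iff.1 hy
  exact csInf_le ⟨0, by rintro _ ⟨q, -, rfl⟩; positivity⟩ ⟨p, hp, rfl⟩

/-- Compactness of the simplex turns the infimum into a minimum; `NeZero m` excludes the empty
simplex, where `sInf` has the default value `0`. -/
theorem exists_distSq_eq [NeZero m] (V : Fin m → EuclideanSpace ℝ (Fin d))
    (u : EuclideanSpace ℝ (Fin d)) :
    ∃ y ∈ rowHull V, distSq u V = ‖u - y‖ ^ 2 := by
  have hc : IsCompact ((fun p : Fin m → ℝ => ‖u - ∑ i, p i • V i‖ ^ 2) '' stdSimplex ℝ (Fin m)) :=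
    (isCompact_stdSimplex ℝ (Fin m)).image (by fun_prop)
  obtain ⟨p, hp, h⟩ := hc.sInf_mem ⟨_, _, single_mem_stdSimplex ℝ (0 : Fin m), rfl⟩
  exact ⟨_, mem_rowHull_iff.2 ⟨p, hp, rfl⟩, h.symm⟩

theorem sqrt_sumDistSq_le {U P : Fin k → EuclideanSpace ℝ (Fin d)}
    {V : Fin m → EuclideanSpace ℝ (Fin d)} (hP : ∀ l, P l ∈ rowHull V) :
    √(sumDistSq U V) ≤ frobNorm (U - P) :=
  Real.sqrt_le_sqrt (Finset.sum_le_sum fun l _ => distSq_le (U l) (hP l))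

theorem exists_sqrt_sumDistSq_eq [NeZero m] (U : Fin k → EuclideanSpace ℝ (Fin d))
    (V : Fin m → EuclideanSpace ℝ (Fin d)) :
    ∃ P : Fin k → EuclideanSpace ℝ (Fin d), (∀ l, P l ∈ rowHull V) ∧
      √(sumDistSq U V) = frobNorm (U - P) := by
  choose P hP h using fun l => exists_distSq_eq V (U l)
  exact ⟨P, hP, by simp only [sumDistSq, frobNorm, h, Pi.sub_apply]⟩

theorem sqrt_sumDistSq_le_add [NeZero m] (U U' : Fin k → EuclideanSpace ℝ (Fin d))
    (V : Fin m → EuclideanSpace ℝ (Fin d)) :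
    √(sumDistSq U V) ≤ frobNorm (U - U') + √(sumDistSq U' V) := by
  obtain ⟨P, hP, h⟩ := exists_sqrt_sumDistSq_eq U' V
  rw [h]
  exact (sqrt_sumDistSq_le hP).trans (frobNorm_sub_le_add _ _ _)

/-- If the rows of `V` are within `η` of a convex set, then so is their convex hull. -/
theorem forall_rowHull_exists_near {V : Fin m → EuclideanSpace ℝ (Fin d)}
    {C : Set (EuclideanSpace ℝ (Fin d))} (hC : Convex ℝ C) {η : ℝ}
    (h : ∀ i, ∃ y ∈ C, ‖V i - y‖ ≤ η) {x : EuclideanSpace ℝ (Fin d)} (hx : x ∈ rowHull V) :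
    ∃ y ∈ C, ‖x - y‖ ≤ η := by
  choose y hy hn using h
  obtain ⟨p, ⟨hp0, hp1⟩, rfl⟩ := mem_rowHull_iff.1 hx
  refine ⟨∑ i, p i • y i, hC.sum_mem (fun i _ => hp0 i) hp1 fun i _ => hy i, ?_⟩
  rw [← Finset.sum_sub_distrib]
  calc ‖∑ i, (p i • V i - p i • y i)‖ ≤ ∑ i, p i * η := by
        refine norm_sum_le_of_le _ fun i _ => ?_
        rw [← smul_sub, norm_smul, Real.norm_of_nonneg (hp0 i)]
        exact mul_le_mul_of_nonneg_left (hn i) (hp0 i)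
    _ = η := by rw [← Finset.sum_mul, hp1, one_mul]

theorem sqrt_sumDistSq_le_of_near {m' : ℕ} [NeZero m] (U : Fin k → EuclideanSpace ℝ (Fin d))
    {V : Fin m → EuclideanSpace ℝ (Fin d)}
    {V' : Fin m' → EuclideanSpace ℝ (Fin d)} {η : ℝ} (hη : 0 ≤ η)
    (h : ∀ x ∈ rowHull V, ∃ y ∈ rowHull V', ‖x - y‖ ≤ η) :
    √(sumDistSq U V') ≤ √(sumDistSq U V) + √k * η := by
  obtain ⟨P, hP, hPU⟩ := exists_sqrt_sumDistSq_eq U V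
  choose Q hQ hPQ using fun l => h _ (hP l)
  rw [hPU]
  refine (sqrt_sumDistSq_le hQ).trans ((frobNorm_sub_le_add _ P _).trans ?_)
  gcongr
  exact frobNorm_le_of_forall_le hPQ hη

theorem exists_near_of_sqrt_sumDistSq_le [NeZero m] {U : Fin k → EuclideanSpace ℝ (Fin d)}
    {V : Fin m → EuclideanSpace ℝ (Fin d)} {η : ℝ}
    (h : √(sumDistSq U V) ≤ η) {x : EuclideanSpace ℝ (Fin d)} (hx : x ∈ rowHull U) :
    ∃ y ∈ rowHull V, ‖x - y‖ ≤ η := by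
  obtain ⟨P, hP, hPU⟩ := exists_sqrt_sumDistSq_eq U V
  refine forall_rowHull_exists_near (convex_rowHull V) (fun i => ⟨P i, hP i, ?_⟩) hx
  exact (norm_le_frobNorm (U - P) i).trans (hPU ▸ h)

/-- The loss lets each archetype choose its own nearest row, so `f` need not be injective. -/
theorem archetypeLoss_le {r : ℕ} (H₀ H : Fin r → EuclideanSpace ℝ (Fin d)) (f : Fin r → Fin r) :
    archetypeLoss H₀ H ≤ frobNorm (H₀ - H ∘ f) ^ 2 := by
  rw [sq_frobNorm]
  exact Finset.sum_le_sum fun l _ =>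
    ciInf_le (f := fun l' => ‖H₀ l - H l'‖ ^ 2) (finite_range _).bddBelow (f l)

end Hull

end Archetypes

/-! ### Singular values as extremal stretching factors -/

namespace LinearMap

open Module

variable {E F : Type*} [NormedAddCommGroup E] [InnerProductSpace ℝ E] [FiniteDimensional ℝ E]
  [NormedAddCommGroup F] [InnerProductSpace ℝ F] [FiniteDimensional ℝ F] (T : E →ₗ[ℝ] F)

/-- Expand `a` in an orthonormal eigenbasis of `adjoint T ∘ₗ T`, whose eigenvalues are the squared
singular values. Both norm bounds below follow termwise. -/
theorem sq_norm_apply_eq_sum_singularValues {n : ℕ} (hn : finrank ℝ E = n) (a : E) :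
    ‖T a‖ ^ 2 = ∑ i : Fin n, T.singularValues i ^ 2 *
      inner ℝ (T.isSymmetric_adjoint_comp_self.eigenvectorBasis hn i) a ^ 2 := by
  set b := T.isSymmetric_adjoint_comp_self.eigenvectorBasis hn with hb
  have h1 : ‖T a‖ ^ 2 = inner ℝ ((adjoint T ∘ₗ T) a) a := by
    rw [coe_comp, Function.comp_apply, adjoint_inner_left, real_inner_self_eq_norm_sq]
  rw [h1, ← b.sum_inner_mul_inner]
  refine Finset.sum_congr rfl fun i _ => ?_
  rw [T.isSymmetric_adjoint_comp_self, hb, T.isSymmetric_adjoint_comp_self.apply_eigenvectorBasis,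
    T.sq_singularValues_fin hn, RCLike.ofReal_real_eq_id, id_eq, inner_smul_right,
    real_inner_comm a]
  ring

theorem norm_apply_le_singularValues_zero (a : E) : ‖T a‖ ≤ T.singularValues 0 * ‖a‖ := by
  refine le_of_sq_le_sq ?_ (mul_nonneg (T.singularValues_nonneg 0) (norm_nonneg a))
  rw [T.sq_norm_apply_eq_sum_singularValues rfl, mul_pow,
    ← (T.isSymmetric_adjoint_comp_self.eigenvectorBasis rfl).sum_sq_norm_inner_right a,
    Finset.mul_sum]
  refine Finset.sum_le_sum fun i _ => ?_
  rw [Real.norm_eq_abs, sq_abs]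
  gcongr
  · exact T.singularValues_nonneg i
  · exact T.singularValues_antitone (Nat.zero_le i)

theorem mul_norm_le_norm_apply {c : ℝ} (hc : 0 ≤ c)
    (h : ∀ i < finrank ℝ E, c ≤ T.singularValues i) (a : E) : c * ‖a‖ ≤ ‖T a‖ := by
  refine le_of_sq_le_sq ?_ (norm_nonneg _)
  rw [T.sq_norm_apply_eq_sum_singularValues rfl, mul_pow,
    ← (T.isSymmetric_adjoint_comp_self.eigenvectorBasis rfl).sum_sq_norm_inner_right a,
    Finset.mul_sum]
  refine Finset.sum_le_sum fun i _ => ?_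
  rw [Real.norm_eq_abs, sq_abs]
  gcongr
  exact h i i.2

end LinearMap

namespace Archetypes

variable {n r d : ℕ}

/-! ### Extreme singular values of a matrix of archetypes -/

section SingularValues

variable (H : Fin r → EuclideanSpace ℝ (Fin d))

theorem sigmaMax_nonneg : 0 ≤ sigmaMax H := LinearMap.singularValues_nonneg _ _

theorem norm_sum_smul_le (a : Fin r → ℝ) : ‖∑ l, a l • H l‖ ≤ sigmaMax H * frobNorm a := by
  rw [frobNorm_eq_norm]
  exact (transposeMap H).norm_apply_le_singularValues_zero (WithLp.toLp 2 a)

variable {H}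

theorem injective_transposeMap (hH : LinearIndependent ℝ H) :
    Function.Injective (transposeMap H) := by
  have h := hH.fintypeLinearCombination_injective
  exact h.comp (WithLp.linearEquiv 2 ℝ (Fin r → ℝ)).injective

theorem sigmaMin_eq_singularValues (hr : r ≠ 0) (hH : LinearIndependent ℝ H) :
    sigmaMin H = (transposeMap H).singularValues (r - 1) := by
  have hfin : Module.finrank ℝ (EuclideanSpace ℝ (Fin r)) = r := by simp
  have hpos := (transposeMap H).injective_iff_forall_lt_finrank_singularValues_pos.1
    (injective_transposeMap hH)
  rw [hfin] at hpos
  refine IsLeast.csInf_eq ⟨⟨(hpos _ (by omega)).ne', _, rfl⟩, ?_⟩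
  -- Indices start at `0`, so `r - 1` is the last positive one; from `r` on the singular values
  -- vanish and are excluded by `hs`.
  rintro s ⟨hs, i, rfl⟩
  refine (transposeMap H).singularValues_antitone ?_
  by_contra! hi
  exact hs ((transposeMap H).singularValues_of_finrank_le (by rw [hfin]; omega))

theorem sigmaMin_pos (hr : r ≠ 0) (hH : LinearIndependent ℝ H) : 0 < sigmaMin H := by
  rw [sigmaMin_eq_singularValues hr hH]
  refine (transposeMap H).injective_iff_forall_lt_finrank_singularValues_pos.1
    (injective_transposeMap hH) _ ?_
  simp only [finrank_euclideanSpace, Fintype.card_fin]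
  omega

theorem sigmaMin_le_sigmaMax (hr : r ≠ 0) (hH : LinearIndependent ℝ H) :
    sigmaMin H ≤ sigmaMax H := by
  rw [sigmaMin_eq_singularValues hr hH]
  exact (transposeMap H).singularValues_antitone (Nat.zero_le _)

theorem sigmaMin_mul_frobNorm_le (hr : r ≠ 0) (hH : LinearIndependent ℝ H) (a : Fin r → ℝ) :
    sigmaMin H * frobNorm a ≤ ‖∑ l, a l • H l‖ := by
  rw [frobNorm_eq_norm]
  refine (transposeMap H).mul_norm_le_norm_apply (sigmaMin_pos hr hH).le (fun i hi => ?_)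
    (WithLp.toLp 2 a)
  rw [sigmaMin_eq_singularValues hr hH]
  refine (transposeMap H).singularValues_antitone ?_
  simp only [finrank_euclideanSpace, Fintype.card_fin] at hi
  omega

theorem norm_sub_le_of_mem_rowHull {x y : EuclideanSpace ℝ (Fin d)} (hx : x ∈ rowHull H)
    (hy : y ∈ rowHull H) :
    ‖x - y‖ ≤ √2 * sigmaMax H := by
  obtain ⟨p, ⟨hp0, hp1⟩, rfl⟩ := mem_rowHull_iff.1 hx
  obtain ⟨q, ⟨hq0, hq1⟩, rfl⟩ := mem_rowHull_iff.1 hy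
  rw [← Finset.sum_sub_distrib]
  simp only [← sub_smul]
  refine (norm_sum_smul_le H (fun l => p l - q l)).trans ?_
  rw [mul_comm]
  refine mul_le_mul_of_nonneg_right (Real.sqrt_le_sqrt ?_) (sigmaMax_nonneg H)
  -- For `p, q` in `[0, 1]`, `(p - q) ^ 2 ≤ p + q`, which gives the factor `√2`.
  calc ∑ l, ‖p l - q l‖ ^ 2 ≤ ∑ l, (p l + q l) := by
        refine Finset.sum_le_sum fun l _ => ?_
        rw [Real.norm_eq_abs, sq_abs]
        have h1 : p l ≤ 1 := hp1 ▸ Finset.single_le_sum (fun i _ => hp0 i) (Finset.mem_univ l)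
        have h2 : q l ≤ 1 := hq1 ▸ Finset.single_le_sum (fun i _ => hq0 i) (Finset.mem_univ l)
        nlinarith [hp0 l, hq0 l, mul_nonneg (hp0 l) (hq0 l)]
    _ = 2 := by rw [Finset.sum_add_distrib, hp1, hq1]; norm_num

end SingularValues

/-! ### The ball around the centroid -/

section Simplex

variable {H : Fin r → EuclideanSpace ℝ (Fin d)}

theorem exists_sum_smul_eq_of_mem_vectorSpan {k : EuclideanSpace ℝ (Fin d)}
    (hk : k ∈ vectorSpan ℝ (range H)) :
    ∃ a : Fin r → ℝ, ∑ l, a l = 0 ∧ ∑ l, a l • H l = k := by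
  classical
  obtain ⟨s, w, hw, rfl⟩ := (mem_vectorSpan_iff_eq_weightedVSub ℝ).1 hk
  refine ⟨fun l => if l ∈ s then w l else 0, by simpa using hw, ?_⟩
  rw [s.weightedVSub_eq_linear_combination hw]
  simp [ite_smul]

/-- A simplex with linearly independent vertices contains a relative ball around its centroid. -/
theorem centroid_add_mem_rowHull (hr : r ≠ 0) (hH : LinearIndependent ℝ H)
    {k : EuclideanSpace ℝ (Fin d)}
    (hk : k ∈ vectorSpan ℝ (range H)) (hn : ‖k‖ ≤ sigmaMin H / r) :
    (∑ l, (r : ℝ)⁻¹ • H l) + k ∈ rowHull H := by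
  obtain ⟨a, ha, rfl⟩ := exists_sum_smul_eq_of_mem_vectorSpan hk
  have hr' : (0 : ℝ) < r := by positivity
  have hs := sigmaMin_pos hr hH
  have h1 : frobNorm a ≤ (r : ℝ)⁻¹ := by
    refine le_of_mul_le_mul_left ?_ hs
    exact (sigmaMin_mul_frobNorm_le hr hH a).trans (by rwa [← div_eq_mul_inv])
  refine mem_rowHull_iff.2 ⟨fun l => (r : ℝ)⁻¹ + a l, ⟨fun l => ?_, ?_⟩, ?_⟩
  · have := (norm_le_frobNorm a l).trans h1
    linarith [(abs_le.1 this).1]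
  · rw [Finset.sum_add_distrib, ha]
    simp [hr]
  · simp only [add_smul, Finset.sum_add_distrib]

theorem centroid_mem_rowHull (hr : r ≠ 0) : ∑ l, (r : ℝ)⁻¹ • H l ∈ rowHull H :=
  mem_rowHull_iff.2 ⟨fun _ => (r : ℝ)⁻¹, ⟨fun _ => by positivity, by simp [hr]⟩, rfl⟩

end Simplex

/-! ### Relative balls, expansions and slopes of affine maps -/

section Convex

variable {E : Type*} [NormedAddCommGroup E] [InnerProductSpace ℝ E] {K : Submodule ℝ E}
  {C : Set E} {z : E}

/-- If a compact convex subset of `z + K` comes within `η` of each point of a relative ball of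
radius `ρ` around `z`, then it contains the concentric ball of radius `ρ - η`. -/
theorem add_mem_of_forall_exists_near (hC : Convex ℝ C) (hcpt : IsCompact C)
    (hCK : ∀ c ∈ C, c - z ∈ K) {ρ η : ℝ} (hρ : 0 ≤ ρ)
    (h : ∀ k ∈ K, ‖k‖ ≤ ρ → ∃ c ∈ C, ‖z + k - c‖ ≤ η) {k : E} (hk : k ∈ K)
    (hkn : ‖k‖ ≤ ρ - η) : z + k ∈ C := by
  have hne : C.Nonempty := by
    obtain ⟨c, hc, -⟩ := h 0 K.zero_mem (by simpa using hρ)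
    exact ⟨c, hc⟩
  -- Let `p` be the point of `C` nearest to `z + k`. If they differ, `C` lies in the half-space
  -- through `p` with outer normal `u`.
  obtain ⟨p, hp, hmin⟩ := exists_norm_eq_iInf_of_complete_convex hne hcpt.isComplete hC (z + k)
  have hinner := (norm_eq_iInf_iff_real_inner_le_zero hC hp).1 hmin
  set u := z + k - p with hu
  have huK : u ∈ K := by
    have := K.sub_mem hk (hCK p hp)
    rwa [show k - (p - z) = u by rw [hu]; abel] at this
  by_cases hu0 : u = 0
  · rwa [sub_eq_zero.1 (hu.symm.trans hu0)]
  exfalso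
  have hn : 0 < ‖u‖ := norm_pos_iff.2 hu0
  -- The point of the `ρ`-ball farthest in direction `u` is more than `η` away from that half-space,
  -- a contradiction.
  obtain ⟨c, hc, hcn⟩ := h ((ρ / ‖u‖) • u) (K.smul_mem _ huK) (by
    rw [norm_smul, norm_div, norm_norm, div_mul_cancel₀ _ hn.ne', Real.norm_of_nonneg hρ])
  have h1 := hinner c hc
  have h2 : inner ℝ u (z + (ρ / ‖u‖) • u - c) ≤ ‖u‖ * η :=
    (real_inner_le_norm _ _).trans (by gcongr)
  have h3 : inner ℝ u k ≤ ‖u‖ * (ρ - η) := (real_inner_le_norm _ _).trans (by gcongr)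
  have h4 : z + (ρ / ‖u‖) • u - c = u - k + (ρ / ‖u‖) • u - (c - p) := by rw [hu]; abel
  rw [h4, inner_sub_right, inner_add_right, inner_sub_right, inner_smul_right,
    real_inner_self_eq_norm_sq] at h2
  have h5 : ρ / ‖u‖ * ‖u‖ ^ 2 = ρ * ‖u‖ := by field_simp
  nlinarith [mul_pos hn hn]

/-- The points within `η` of a convex set that contains a relative ball of radius `ρ` around `z`
lie in its homothetic image with centre `z` and ratio `1 + η / ρ`. -/
theorem add_inv_smul_mem_of_near (hC : Convex ℝ C) {ρ η : ℝ} (hρ : 0 < ρ)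
    (hball : ∀ k ∈ K, ‖k‖ ≤ ρ → z + k ∈ C) {x c : E} (hc : c ∈ C) (hxc : x - c ∈ K)
    (hn : ‖x - c‖ ≤ η) : z + (1 + η / ρ)⁻¹ • (x - z) ∈ C := by
  rcases ((norm_nonneg _).trans hn).eq_or_lt with rfl | hη
  · rw [sub_eq_zero.1 (norm_le_zero_iff.1 hn)]
    simpa using hc
  -- The target is a convex combination of `c` and this boundary point, with weights in the ratio `1
  -- : η / ρ`.
  have hb : z + (ρ / η) • (x - c) ∈ C := by
    refine hball _ (K.smul_mem _ hxc) ?_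
    rw [norm_smul, Real.norm_of_nonneg (by positivity), div_mul_eq_mul_div, div_le_iff₀ hη]
    gcongr
  have hpos : (0 : ℝ) < 1 + η / ρ := by positivity
  have := hC hc hb (a := (1 + η / ρ)⁻¹) (b := (1 + η / ρ)⁻¹ * (η / ρ)) (by positivity)
    (by positivity) (by field_simp)
  convert this using 1
  have h1 : z = (1 + η / ρ)⁻¹ • ((1 + η / ρ) • z) := by
      rw [smul_smul, inv_mul_cancel₀ hpos.ne', one_smul]
  have h2 : (η / ρ) • (ρ / η) • (x - c) = x - c := by
    rw [smul_smul, show η / ρ * (ρ / η) = 1 by field_simp, one_smul]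
  nth_rewrite 1 [h1]
  rw [mul_smul, ← smul_add, ← smul_add, smul_add (η / ρ), h2, add_smul, one_smul]
  congr 1
  abel

/-- Suppose that the simplex with vertices `V` in `z + K` comes within `η` of each point of a
relative ball of radius `μ`, at weights where the combination of the vectors `G` is at most `η`.
Then the affine map that extends `V l ↦ G l` has slope at most `η / (μ - η)`. -/
theorem exists_slope_bound [FiniteDimensional ℝ E] {r : ℕ} (hK : Module.finrank ℝ K + 1 = r)
    {V G : Fin r → E} (hV : ∀ l, V l - z ∈ K) {μ η : ℝ} (hη : 0 ≤ η) (hημ : η < μ)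
    (hball : ∀ k ∈ K, ‖k‖ ≤ μ - η → z + k ∈ convexHull ℝ (range V))
    (h : ∀ k ∈ K, ‖k‖ ≤ μ → ∃ p ∈ stdSimplex ℝ (Fin r),
      ‖∑ l, p l • V l - (z + k)‖ ≤ η ∧ ‖∑ l, p l • G l‖ ≤ η) :
    ∃ N : ℝ, 0 ≤ N ∧ N * (μ - η) ≤ η ∧ ∀ l, ‖G l‖ ≤ η * (1 + N) + N * ‖V l - z‖ := by
  have hμ : 0 < μ := hη.trans_lt hημ
  -- Homogenization: affine maps on `z + K` become linear maps on `K × ℝ`. The lifted vertices span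
  -- because their hull contains a ball, and the dimension count makes them a basis.
  set v : Fin r → K × ℝ := fun l => (⟨V l - z, hV l⟩, 1) with hv
  have hsum : ∀ p : Fin r → ℝ, ∑ l, p l = 1 →
      ∑ l, p l • v l = (∑ l, p l • (⟨V l - z, hV l⟩ : K), 1) := by
    intro p hp
    ext1
    · simp [hv, Prod.fst_sum]
    · simp [hv, Prod.snd_sum, hp]
  have hcoe : ∀ p : Fin r → ℝ, ∑ l, p l = 1 →
      ((∑ l, p l • (⟨V l - z, hV l⟩ : K) : K) : E) = ∑ l, p l • V l - z := by
    intro p hp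
    simp [smul_sub, Finset.sum_sub_distrib, ← Finset.sum_smul, hp]
  have hspan1 : ∀ k : K, ‖k‖ ≤ μ - η → ((k, 1) : K × ℝ) ∈ Submodule.span ℝ (range v) := by
    intro k hk
    obtain ⟨p, hp, hpk⟩ := mem_convexHull_range_iff.1 (hball k k.2 hk)
    have h1 : ((k, 1) : K × ℝ) = ∑ l, p l • v l := by
      rw [hsum p hp.2, Prod.mk.injEq]
      exact ⟨Subtype.ext (by rw [hcoe p hp.2, hpk, add_sub_cancel_left]), rfl⟩
    rw [h1]
    exact Submodule.sum_mem _ fun l _ => Submodule.smul_mem _ _ (Submodule.subset_span ⟨l, rfl⟩)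
  have hspan : ⊤ ≤ Submodule.span ℝ (range v) := by
    rintro ⟨k, s⟩ -
    have ht : 0 < (μ - η) / (‖k‖ + 1) := div_pos (by linarith) (by positivity)
    have h1 := hspan1 (((μ - η) / (‖k‖ + 1)) • k) (by
      rw [norm_smul, Real.norm_of_nonneg ht.le, div_mul_eq_mul_div, div_le_iff₀ (by positivity)]
      nlinarith [norm_nonneg k])
    have h0 := hspan1 0 (by simpa using hημ.le)
    have h2 := Submodule.add_mem _
      (Submodule.smul_mem _ ((μ - η) / (‖k‖ + 1))⁻¹ (Submodule.sub_mem _ h1 h0))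
      (Submodule.smul_mem _ s h0)
    convert h2 using 1
    simp only [Prod.mk_sub_mk, sub_zero, sub_self, Prod.smul_mk, smul_smul, inv_mul_cancel₀ ht.ne',
      one_smul, smul_zero, smul_eq_mul, mul_one, mul_zero, Prod.mk_add_mk, add_zero, zero_add]
  have hcard : Fintype.card (Fin r) = Module.finrank ℝ (K × ℝ) := by
    simp [hK]
  set b := basisOfTopLeSpanOfCardEqFinrank v hspan hcard with hb
  set f : K × ℝ →ₗ[ℝ] E := b.constr ℝ G with hf
  have hfv : ∀ l, f (v l) = G l := by
    intro l
    have : b l = v l := by rw [hb, coe_basisOfTopLeSpanOfCardEqFinrank]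
    rw [← this, hf, b.constr_basis]
  set Λ : K →L[ℝ] E := LinearMap.toContinuousLinearMap (f ∘ₗ LinearMap.inl ℝ K ℝ) with hΛ
  set c : E := f (0, 1) with hc
  have hsplit : ∀ k : K, f (k, 1) = Λ k + c := by
    intro k
    have : ((k, 1) : K × ℝ) = (k, 0) + (0, 1) := by simp
    rw [this, map_add]
    rfl
  set N := ‖Λ‖ with hN
  have hN0 : 0 ≤ N := Λ.opNorm_nonneg
  -- Compare `k` with the nearby combination `y`, where the map is at most `η`; moving from `y` to
  -- `k` costs `N * η`.
  have hnear : ∀ k : K, ‖k‖ ≤ μ → ‖Λ k + c‖ ≤ η * (1 + N) := by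
    intro k hk
    obtain ⟨p, ⟨hp0, hp1⟩, hpV, hpG⟩ := h k k.2 hk
    have h1 : Λ (∑ l, p l • (⟨V l - z, hV l⟩ : K)) + c = ∑ l, p l • G l := by
      rw [← hsplit, ← hsum p hp1, map_sum]
      simp [hfv]
    set y : K := ∑ l, p l • (⟨V l - z, hV l⟩ : K) with hy
    have h2 : ‖y - k‖ ≤ η := by
      rw [← Submodule.norm_coe, Submodule.coe_sub, hy, hcoe p hp1, sub_sub]
      exact hpV
    have h3 : Λ k + c = (Λ y + c) - Λ (y - k) := by rw [map_sub]; abel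
    rw [h3, h1]
    calc _ ≤ ‖∑ l, p l • G l‖ + ‖Λ (y - k)‖ := norm_sub_le _ _
      _ ≤ η + N * η := add_le_add hpG ((Λ.le_opNorm _).trans (by gcongr))
      _ = _ := by ring
  -- Subtracting the estimates at `k` and `-k` removes the constant term `c`.
  have hball' : ∀ k : K, ‖k‖ ≤ μ → ‖Λ k‖ ≤ η * (1 + N) := by
    intro k hk
    have h1 := hnear k hk
    have h2 := hnear (-k) (by rwa [norm_neg])
    have h3 : (2 : ℝ) • Λ k = (Λ k + c) - (Λ (-k) + c) := by rw [map_neg, two_smul]; abel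
    have h4 := norm_sub_le (Λ k + c) (Λ (-k) + c)
    rw [← h3, norm_smul, Real.norm_two] at h4
    linarith
  -- The bound on the ball gives an inequality with `N` on both sides; solving it uses `η < μ`.
  have hNle : N ≤ η * (1 + N) / μ := by
    refine Λ.opNorm_le_bound (by positivity) fun k => ?_
    by_cases hk : k = 0
    · simp [hk]
    have hkn : 0 < ‖k‖ := norm_pos_iff.2 hk
    have h1 := hball' ((μ / ‖k‖) • k) (by
      rw [norm_smul, norm_div, norm_norm, div_mul_cancel₀ _ hkn.ne', Real.norm_of_nonneg hμ.le])
    rw [map_smul, norm_smul, Real.norm_of_nonneg (by positivity), div_mul_eq_mul_div,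
      div_le_iff₀ hkn] at h1
    rw [div_mul_eq_mul_div, le_div_iff₀ hμ]
    linarith
  rw [le_div_iff₀ hμ] at hNle
  refine ⟨N, hN0, by linarith, fun l => ?_⟩
  have h1 := hnear 0 (by simpa using hμ.le)
  rw [map_zero, zero_add] at h1
  have h2 : G l = c + Λ ⟨V l - z, hV l⟩ := by rw [add_comm, ← hsplit, ← hfv]
  rw [h2]
  exact (norm_add_le _ _).trans (add_le_add h1 (Λ.le_opNorm _))

end Convex

/-! ### From close simplices to close vertices -/

/-- The entries of `q` other than `q k` are nonnegative with sum `1 - q k`, so their squares sum to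
at most `(1 - q k) ^ 2`. -/
theorem frobNorm_single_sub_le {q : Fin r → ℝ} (hq : q ∈ stdSimplex ℝ (Fin r)) (k : Fin r) :
    frobNorm (Pi.single k 1 - q) ≤ √2 * (1 - q k) := by
  obtain ⟨hq0, hq1⟩ := hq
  have hsum : q k + ∑ j ∈ Finset.univ.erase k, q j = 1 := by
    rw [Finset.add_sum_erase _ _ (Finset.mem_univ k), hq1]
  have hs : 0 ≤ 1 - q k := by
    rw [← hsum, add_sub_cancel_left]
    exact Finset.sum_nonneg fun j _ => hq0 j
  have h1 : ∑ j ∈ Finset.univ.erase k, ‖(Pi.single k 1 - q : Fin r → ℝ) j‖ ^ 2 ≤ (1 - q k) ^ 2 := by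
    calc _ ≤ ∑ j ∈ Finset.univ.erase k, (1 - q k) * q j := by
          refine Finset.sum_le_sum fun j hj => ?_
          have h2 : q j ≤ ∑ j ∈ Finset.univ.erase k, q j :=
            Finset.single_le_sum (fun i _ => hq0 i) hj
          rw [Pi.sub_apply, Pi.single_eq_of_ne (Finset.ne_of_mem_erase hj), zero_sub, norm_neg,
            Real.norm_eq_abs, sq_abs, sq]
          exact mul_le_mul_of_nonneg_right (by linarith) (hq0 j)
      _ = _ := by rw [← Finset.mul_sum, sq]; congr 1; linarith
  rw [frobNorm, ← Real.sqrt_sq hs, ← Real.sqrt_mul zero_le_two]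
  refine Real.sqrt_le_sqrt ?_
  rw [← Finset.add_sum_erase _ _ (Finset.mem_univ k), Pi.sub_apply, Pi.single_eq_same,
    Real.norm_eq_abs, sq_abs]
  linarith

/-- Cauchy–Schwarz in each row, then exchange of sums: only the column sums of `w` matter. These are
bounded by `r` in general and by `2` for nearby simplices. -/
theorem frobNorm_sum_smul_le {E : Type*} [NormedAddCommGroup E] [NormedSpace ℝ E]
    {w : Fin r → Fin r → ℝ} (hw : ∀ k, w k ∈ stdSimplex ℝ (Fin r)) {M : ℝ}
    (hM : ∀ l, ∑ k, w k l ≤ M) (e : Fin r → E) :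
    frobNorm (fun k => ∑ l, w k l • e l) ≤ √M * frobNorm e := by
  have h1 : ∀ k, ‖∑ l, w k l • e l‖ ^ 2 ≤ ∑ l, w k l * ‖e l‖ ^ 2 := by
    intro k
    have h2 : ‖∑ l, w k l • e l‖ ≤ ∑ l, w k l * ‖e l‖ :=
      norm_sum_le_of_le _ fun l _ => by rw [norm_smul, Real.norm_of_nonneg ((hw k).1 l)]
    have h3 := Finset.sum_sq_le_sum_mul_sum_of_sq_le_mul Finset.univ
      (r := fun l => w k l * ‖e l‖) (f := fun l => w k l) (g := fun l => w k l * ‖e l‖ ^ 2)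
      (fun l _ => (hw k).1 l) (fun l _ => mul_nonneg ((hw k).1 l) (by positivity))
      (fun l _ => le_of_eq (by ring))
    rw [(hw k).2, one_mul] at h3
    exact (pow_le_pow_left₀ (norm_nonneg _) h2 2).trans h3
  rw [frobNorm, frobNorm, ← Real.sqrt_mul' _ (by positivity)]
  refine Real.sqrt_le_sqrt ?_
  calc _ ≤ ∑ k, ∑ l, w k l * ‖e l‖ ^ 2 := Finset.sum_le_sum fun k _ => h1 k
    _ = ∑ l, (∑ k, w k l) * ‖e l‖ ^ 2 := by
        rw [Finset.sum_comm]
        simp only [Finset.sum_mul]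
    _ ≤ ∑ l, M * ‖e l‖ ^ 2 := by gcongr; exact hM _
    _ = _ := by rw [Finset.mul_sum]

/-- Closeness of the convex hulls of `H₀` and `H` forces closeness of their vertices. -/
theorem exists_vertex_selection (hr : r ≠ 0) {H₀ : Fin r → EuclideanSpace ℝ (Fin d)}
    (hH₀ : LinearIndependent ℝ H₀) (H : Fin r → EuclideanSpace ℝ (Fin d)) {a b : ℝ}
    (ha : √(sumDistSq H H₀) = a) (hb : √(sumDistSq H₀ H) = b) :
    ∃ f : Fin r → Fin r,
      frobNorm (H₀ - H ∘ f) ≤ √2 * condNumber H₀ * (√r * a + b) + √r * a ∧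
      (r * (a + b) ≤ sigmaMin H₀ →
        frobNorm (H₀ - H ∘ f) ≤ √2 * condNumber H₀ * (√2 * a + b) + √r * a) := by
  have : NeZero r := ⟨hr⟩
  have hs := sigmaMin_pos hr hH₀
  have hS := sigmaMax_nonneg H₀
  obtain ⟨P, hP, hPa⟩ := exists_sqrt_sumDistSq_eq H H₀
  obtain ⟨R, hR, hRb⟩ := exists_sqrt_sumDistSq_eq H₀ H
  rw [ha] at hPa
  rw [hb] at hRb
  choose q hq hqP using fun l => mem_rowHull_iff.1 (hP l)
  choose w hw hwR using fun k => mem_rowHull_iff.1 (hR k)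
  have ha0 : 0 ≤ a := hPa ▸ frobNorm_nonneg _
  have hb0 : 0 ≤ b := hRb ▸ frobNorm_nonneg _
  have hq_le : ∀ l k, q l k ≤ 1 := fun l k =>
    (hq l).2 ▸ Finset.single_le_sum (fun i _ => (hq l).1 i) (Finset.mem_univ k)
  have hw_le : ∀ l k, w l k ≤ 1 := fun l k =>
    (hw l).2 ▸ Finset.single_le_sum (fun i _ => (hw l).1 i) (Finset.mem_univ k)
  -- `t k` is the defect of the `k`-th diagonal entry of the product `w q` from `1`; it is also a
  -- weighted mean of the numbers `1 - q l k`.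
  set t : Fin r → ℝ := fun k => ∑ l, w k l * (1 - q l k) with ht
  have ht' : ∀ k, t k = 1 - ∑ l, w k l * q l k := by
    intro k
    simp only [ht, mul_sub, mul_one, Finset.sum_sub_distrib, (hw k).2]
  have ht0 : ∀ k, 0 ≤ t k := fun k =>
    Finset.sum_nonneg fun l _ => mul_nonneg ((hw k).1 l) (by linarith [hq_le l k])
  set e := H - P with he
  set g := H₀ - R with hg
  set y : Fin r → EuclideanSpace ℝ (Fin d) := fun k => ∑ l, w k l • e l with hy
  have htb : ∀ k, sigmaMin H₀ * t k ≤ ‖g k‖ + ‖y k‖ := by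
    intro k
    -- The `k`-th row of the identity minus `w q`: its combination of archetypes is a sum of
    -- projection errors, so `sigmaMin H₀` controls its entries.
    set c : Fin r → ℝ := Pi.single k 1 - fun j => ∑ l, w k l * q l j with hc
    have h1 : ∑ j, c j • H₀ j = g k + y k := by
      have h2 : ∑ j, (∑ l, w k l * q l j) • H₀ j = ∑ l, w k l • P l := by
        simp only [← hqP, Finset.smul_sum, Finset.sum_smul, smul_smul]
        rw [Finset.sum_comm]
      simp only [hc, hg, hy, he, Pi.sub_apply, sub_smul, smul_sub, Finset.sum_sub_distrib, h2,
        ← hwR k]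
      simp [Pi.single_apply, ite_smul]
    have h3 := sigmaMin_mul_frobNorm_le hr hH₀ c
    have h4 : t k ≤ frobNorm c := by
      refine le_trans (le_of_eq ?_) ((le_abs_self _).trans (norm_le_frobNorm c k))
      rw [ht', hc, Pi.sub_apply, Pi.single_eq_same]
    calc sigmaMin H₀ * t k ≤ sigmaMin H₀ * frobNorm c := by gcongr
      _ ≤ ‖∑ j, c j • H₀ j‖ := h3
      _ ≤ _ := h1 ▸ norm_add_le _ _
  have htF : frobNorm t ≤ (frobNorm y + b) / sigmaMin H₀ := by
    rw [le_div_iff₀ hs, mul_comm, ← frobNorm_smul_of_nonneg hs.le, add_comm, hRb]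
    refine frobNorm_le_add fun k => ?_
    rw [Pi.smul_apply, smul_eq_mul, Real.norm_of_nonneg (mul_nonneg hs.le (ht0 k))]
    exact htb k
  -- The smallest of the numbers `1 - q l k` is at most their weighted mean.
  have hfex : ∀ k, ∃ l, 1 - q l k ≤ t k := by
    intro k
    obtain ⟨l, hl⟩ := Finite.exists_max fun l => q l k
    refine ⟨l, ?_⟩
    calc 1 - q l k = ∑ l', w k l' * (1 - q l k) := by rw [← Finset.sum_mul, (hw k).2, one_mul]
      _ ≤ t k := Finset.sum_le_sum fun l' _ =>
        mul_le_mul_of_nonneg_left (by linarith [hl l']) ((hw k).1 l')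
  choose f hf using hfex
  have hmain : frobNorm (H₀ - H ∘ f) ≤ √2 * sigmaMax H₀ * frobNorm t + √r * a := by
    have h1 : frobNorm (H₀ - H ∘ f) ≤ √2 * sigmaMax H₀ * frobNorm t + frobNorm (e ∘ f) := by
      rw [← frobNorm_smul_of_nonneg (show 0 ≤ √2 * sigmaMax H₀ by positivity)]
      refine frobNorm_le_add fun k => ?_
      have h2 : (H₀ - H ∘ f) k = (∑ j, (Pi.single k 1 - q (f k) : Fin r → ℝ) j • H₀ j)
          - (e ∘ f) k := by
        simp only [he, Pi.sub_apply, Function.comp_apply, sub_smul, Finset.sum_sub_distrib, hqP]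
        simp [Pi.single_apply, ite_smul]
      rw [h2]
      refine (norm_sub_le _ _).trans (add_le_add_left ?_ _)
      rw [Pi.smul_apply, smul_eq_mul, Real.norm_of_nonneg (mul_nonneg (by positivity) (ht0 k))]
      calc _ ≤ sigmaMax H₀ * frobNorm (Pi.single k 1 - q (f k) : Fin r → ℝ) :=
            norm_sum_smul_le H₀ _
        _ ≤ sigmaMax H₀ * (√2 * t k) := by
            gcongr
            exact (frobNorm_single_sub_le (hq _) k).trans (by gcongr; exact hf k)
        _ = _ := by ring
    -- Since `f` may repeat an index, each selected error is bounded by `a` separately; hence the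
    -- factor `√r`.
    refine h1.trans (add_le_add_right ?_ _)
    refine frobNorm_le_of_forall_le (fun k => ?_) ha0
    rw [hPa]
    exact norm_le_frobNorm e (f k)
  have hconcl : ∀ m, frobNorm y ≤ m →
      frobNorm (H₀ - H ∘ f) ≤ √2 * condNumber H₀ * (m + b) + √r * a := by
    intro m hm
    refine hmain.trans (add_le_add_left ?_ _)
    rw [condNumber, mul_assoc, mul_assoc, div_mul_eq_mul_div, mul_div_assoc]
    gcongr
    exact htF.trans (by gcongr)
  have hy1 : frobNorm y ≤ √r * a := by
    rw [hPa]
    refine frobNorm_sum_smul_le hw (fun l => ?_) e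
    calc ∑ k, w k l ≤ ∑ _k : Fin r, (1 : ℝ) := Finset.sum_le_sum fun k _ => hw_le k l
      _ = r := by simp
  refine ⟨f, hconcl _ hy1, fun hsmall => hconcl _ ?_⟩
  have htsum : ∑ k, t k ≤ 1 := by
    have h1 := sum_norm_le_sqrt_mul_frobNorm t
    simp only [Real.norm_of_nonneg (ht0 _)] at h1
    have hr1 : √(r : ℝ) ≤ r := by
      have : (1 : ℝ) ≤ r := by exact_mod_cast Nat.one_le_iff_ne_zero.2 hr
      exact Real.sqrt_le_iff.2 ⟨by positivity, by nlinarith⟩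
    calc ∑ k, t k ≤ √r * ((√r * a + b) / sigmaMin H₀) :=
          h1.trans (by gcongr; exact htF.trans (by gcongr))
      _ = (√r * √r * a + √r * b) / sigmaMin H₀ := by ring
      _ ≤ r * (a + b) / sigmaMin H₀ := by
          rw [Real.mul_self_sqrt (Nat.cast_nonneg r), mul_add]
          gcongr
      _ ≤ 1 := (div_le_one hs).2 hsmall
  rw [hPa]
  refine frobNorm_sum_smul_le hw (fun l => ?_) e
  -- A column sum of `w` splits into a part below a row sum of `q`, which is `1`, and a part below
  -- the total defect, at most `1` by `htsum`.
  calc ∑ k, w k l = ∑ k, w k l * q l k + ∑ k, w k l * (1 - q l k) := by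
        rw [← Finset.sum_add_distrib]
        exact Finset.sum_congr rfl fun k _ => by ring
    _ ≤ ∑ k, q l k + ∑ k, t k := by
        refine add_le_add (Finset.sum_le_sum fun k _ => ?_) (Finset.sum_le_sum fun k _ => ?_)
        · exact mul_le_of_le_one_left ((hq l).1 k) (hw_le k l)
        · exact Finset.single_le_sum (f := fun l => w k l * (1 - q l k))
            (fun l _ => mul_nonneg ((hw k).1 l) (by linarith [hq_le l k])) (Finset.mem_univ l)
    _ ≤ 2 := by rw [(hq l).2]; linarith

/-! ### The size of the uniqueness parameter -/

/-- The uniqueness parameter of a factorization is at most one. -/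
theorem IsUniqueWith.le_one {α : ℝ} {X₀ : Fin n → EuclideanSpace ℝ (Fin d)}
    {H₀ : Fin r → EuclideanSpace ℝ (Fin d)} (h : IsUniqueWith α X₀ H₀) (hα : 0 < α) [NeZero n]
    (hr : 2 ≤ r) (hH₀ : LinearIndependent ℝ H₀) (hX₀ : ∀ i, X₀ i ∈ rowHull H₀) : α ≤ 1 := by
  have : NeZero r := ⟨by omega⟩
  set z := X₀ 0 with hz
  set D : Fin r → EuclideanSpace ℝ (Fin d) := fun l => H₀ l - z with hD
  obtain ⟨q, hq, hqz⟩ := mem_rowHull_iff.1 (hX₀ 0)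
  have hpos : 0 < frobNorm D := by
    refine (frobNorm_nonneg D).lt_of_ne fun h0 => ?_
    have h1 : ∀ l, H₀ l = z := fun l =>
      sub_eq_zero.1 (norm_le_zero_iff.1 (h0 ▸ norm_le_frobNorm D l))
    have h2 := hH₀.injective ((h1 ⟨0, by omega⟩).trans (h1 ⟨1, by omega⟩).symm)
    simp at h2
  set c := √r * (√2 * sigmaMax H₀) with hc
  have hc0 : 0 ≤ c := by have := sigmaMax_nonneg H₀; positivity
  -- Expand `H₀` about a data point by `1 + t`: the distances to `X₀` and to conv(H₀) both grow like
  -- `t * frobNorm D`, so large `t` forces `α ≤ 1`.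
  have key : ∀ t : ℝ, 0 ≤ t → α * (t * frobNorm D - c) ≤ t * frobNorm D := by
    intro t ht
    set H : Fin r → EuclideanSpace ℝ (Fin d) := fun l => H₀ l + t • D l with hH
    have ht1 : (0 : ℝ) < 1 + t := by linarith
    have hzH : z ∈ rowHull H := by
      refine mem_rowHull_iff.2 ⟨q, hq, ?_⟩
      simp only [hH, hD, smul_add, smul_comm _ t, smul_sub, Finset.sum_add_distrib,
        Finset.sum_sub_distrib, ← Finset.smul_sum, ← Finset.sum_smul, hqz, hq.2, one_smul]
      rw [sub_self, add_zero]
    have hsub : rowHull X₀ ⊆ rowHull H := by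
      refine (rowHull_subset (convex_rowHull H₀) hX₀).trans
        (rowHull_subset (convex_rowHull H) fun l => ?_)
      have := convex_rowHull H (mem_rowHull_self H l) hzH (a := (1 + t)⁻¹) (b := (1 + t)⁻¹ * t)
        (by positivity) (by positivity) (by field_simp)
      convert this using 1
      rw [mul_smul, ← smul_add, eq_inv_smul_iff₀ ht1.ne', add_smul, one_smul]
      simp only [hH, hD, smul_sub]
      abel
    have h1 := h H hsub
    have h2 : √(sumDistSq H X₀) ≤ t * frobNorm D + √(sumDistSq H₀ X₀) := by
      refine (sqrt_sumDistSq_le_add H H₀ X₀).trans (add_le_add_left (le_of_eq ?_) _)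
      rw [← frobNorm_smul_of_nonneg ht]
      congr 1
      ext1 l
      simp [hH]
    obtain ⟨P, hP, hPH⟩ := exists_sqrt_sumDistSq_eq H H₀
    have h3 : t * frobNorm D ≤ frobNorm (H - P) + c := by
      rw [← frobNorm_smul_of_nonneg ht]
      have h4 : frobNorm (P - H₀) ≤ c := frobNorm_le_of_forall_le
        (fun l => norm_sub_le_of_mem_rowHull (hP l) (mem_rowHull_self H₀ l))
        (by have := sigmaMax_nonneg H₀; positivity)
      refine le_trans ?_ (add_le_add_right h4 _)
      have h5 : t • D = (H - P) + (P - H₀) := by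
        ext1 l
        simp [hH]
      rw [h5]
      exact frobNorm_add_le _ _
    have h6 : 0 ≤ α * √(sumDistSq H₀ H) := by positivity
    have h7 : α * (t * frobNorm D - c) ≤ α * √(sumDistSq H H₀) := by
      gcongr
      linarith
    linarith
  by_contra! hα1
  have h1 : 0 < α - 1 := by linarith
  have := key ((α * c + 1) / ((α - 1) * frobNorm D)) (by positivity)
  have h2 : (α * c + 1) / ((α - 1) * frobNorm D) * frobNorm D = (α * c + 1) / (α - 1) := by
    field_simp
  rw [h2] at this
  have h3 : (α - 1) * ((α * c + 1) / (α - 1)) = α * c + 1 := by field_simp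
  linarith

/-! ### The affine hull of the archetypes -/

section Span

variable {H₀ : Fin r → EuclideanSpace ℝ (Fin d)}

theorem sub_mem_vectorSpan_of_mem_rowHull {x y : EuclideanSpace ℝ (Fin d)} (hx : x ∈ rowHull H₀)
    (hy : y ∈ rowHull H₀) : x - y ∈ vectorSpan ℝ (range H₀) := by
  rw [← direction_affineSpan]
  exact AffineSubspace.vsub_mem_direction (convexHull_subset_affineSpan _ hx)
    (convexHull_subset_affineSpan _ hy)

theorem finrank_vectorSpan_add_one (hr : r ≠ 0) (hH₀ : LinearIndependent ℝ H₀) :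
    Module.finrank ℝ (vectorSpan ℝ (range H₀)) + 1 = r := by
  rw [hH₀.affineIndependent.finrank_vectorSpan (n := r - 1) (by simp; omega)]
  omega

/-- The range of `U` consists of directions of conv(H₀) and has the full dimension `r - 1`, so the
given ball is the whole relative ball. -/
theorem ContainsBall.add_mem {X₀ : Fin n → EuclideanSpace ℝ (Fin d)}
    {z₀ : EuclideanSpace ℝ (Fin d)} {μ : ℝ} (h : ContainsBall (r - 1) X₀ z₀ μ) (hμ : 0 < μ)
    (hr : r ≠ 0) (hH₀ : LinearIndependent ℝ H₀) (hX₀ : ∀ i, X₀ i ∈ rowHull H₀)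
    {k : EuclideanSpace ℝ (Fin d)} (hk : k ∈ vectorSpan ℝ (range H₀)) (hkn : ‖k‖ ≤ μ) :
    z₀ + k ∈ rowHull X₀ := by
  obtain ⟨U, hU⟩ := h
  have hsub := rowHull_subset (convex_rowHull H₀) hX₀
  have hz : z₀ ∈ rowHull X₀ := by simpa using hU 0 (by simpa using hμ.le)
  have hle : LinearMap.range U.toLinearMap ≤ vectorSpan ℝ (range H₀) := by
    rintro _ ⟨w, rfl⟩
    by_cases hw : w = 0
    · simp [hw]
    have hwn : 0 < ‖w‖ := norm_pos_iff.2 hw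
    have h1 := sub_mem_vectorSpan_of_mem_rowHull (hsub (hU ((μ / ‖w‖) • w) (by
      rw [norm_smul, norm_div, norm_norm, div_mul_cancel₀ _ hwn.ne', Real.norm_of_nonneg hμ.le])))
      (hsub hz)
    rw [add_sub_cancel_left, map_smul] at h1
    exact (Submodule.smul_mem_iff _ (by positivity)).1 h1
  have heq : LinearMap.range U.toLinearMap = vectorSpan ℝ (range H₀) := by
    refine Submodule.eq_of_le_of_finrank_eq hle ?_
    rw [LinearMap.finrank_range_of_inj U.injective, finrank_euclideanSpace, Fintype.card_fin]
    have := finrank_vectorSpan_add_one hr hH₀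
    omega
  rw [← heq] at hk
  obtain ⟨w, rfl⟩ := hk
  exact hU w (by simpa using hkn)

end Span

/-! ### Projection and expansion of the estimator -/

/-- Expanding `V` about the centre of a ball in its convex hull until it covers `X₀`. -/
theorem IsUniqueWith.bound_of_near {α : ℝ} {X₀ : Fin n → EuclideanSpace ℝ (Fin d)}
    {H₀ V : Fin r → EuclideanSpace ℝ (Fin d)} (h : IsUniqueWith α X₀ H₀) [NeZero n]
    {K : Submodule ℝ (EuclideanSpace ℝ (Fin d))} {z : EuclideanSpace ℝ (Fin d)} {ρ η : ℝ}
    (hρ : 0 < ρ) (hη : 0 ≤ η) (hball : ∀ k ∈ K, ‖k‖ ≤ ρ → z + k ∈ rowHull V)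
    (hXV : ∀ i, ∃ y ∈ rowHull V, ‖X₀ i - y‖ ≤ η) (hXK : ∀ i, X₀ i - z ∈ K)
    (hVK : ∀ l, V l - z ∈ K) {H : Fin r → EuclideanSpace ℝ (Fin d)}
    (hH : ∀ l, H l = z + (1 + η / ρ) • (V l - z)) :
    √(sumDistSq H₀ X₀) + α * (√(sumDistSq H H₀) + √(sumDistSq H₀ H)) ≤
      √(sumDistSq V X₀) + η / ρ * frobNorm (fun l => V l - z) := by
  have hε : 0 ≤ η / ρ := by positivity
  have hsub : rowHull X₀ ⊆ rowHull H := by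
    refine rowHull_subset (convex_rowHull H) fun i => ?_
    obtain ⟨y, hy, hyn⟩ := hXV i
    have hyK : X₀ i - y ∈ K := by
      simpa using K.sub_mem (hXK i) (sub_mem_of_mem_rowHull hVK hy)
    obtain ⟨p, hp, hpx⟩ := mem_rowHull_iff.1
      (add_inv_smul_mem_of_near (convex_rowHull V) hρ hball hy hyK hyn)
    refine mem_rowHull_iff.2 ⟨p, hp, ?_⟩
    simp only [hH, smul_add, smul_comm _ (1 + η / ρ), smul_sub, Finset.sum_add_distrib,
      Finset.sum_sub_distrib, ← Finset.smul_sum, ← Finset.sum_smul, hpx, hp.2, one_smul]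
    rw [← smul_sub, add_sub_cancel_left, ← smul_sub, smul_inv_smul₀ (by positivity)]
    abel
  refine (h H hsub).trans ?_
  refine (sqrt_sumDistSq_le_add H V X₀).trans ?_
  rw [add_comm, ← frobNorm_smul_of_nonneg hε]
  refine add_le_add_right (le_of_eq ?_) _
  congr 1
  ext1 l
  simp only [Pi.sub_apply, hH, add_smul, one_smul, Pi.smul_apply]
  abel

/-- The projection `V` of an estimator onto the affine hull of the archetypes: its convex hull
still nearly covers the data, and the rows move by an amount controlled by `η`. -/
theorem exists_projection {X₀ : Fin n → EuclideanSpace ℝ (Fin d)}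
    {Hhat : Fin r → EuclideanSpace ℝ (Fin d)} [NeZero n]
    {K : Submodule ℝ (EuclideanSpace ℝ (Fin d))} (hK : Module.finrank ℝ K + 1 = r)
    {z₀ : EuclideanSpace ℝ (Fin d)} {μ η : ℝ} (hη : 0 ≤ η) (hημ : η < μ)
    (hball : ∀ k ∈ K, ‖k‖ ≤ μ → z₀ + k ∈ rowHull X₀)
    (hXK : ∀ i, X₀ i - z₀ ∈ K) (hnear : ∀ i, ∃ y ∈ rowHull Hhat, ‖X₀ i - y‖ ≤ η) :
    ∃ V : Fin r → EuclideanSpace ℝ (Fin d),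
      (∀ l, V l - z₀ ∈ K) ∧ (∀ i, ∃ y ∈ rowHull V, ‖X₀ i - y‖ ≤ η) ∧
      √(sumDistSq V X₀) ≤ √(sumDistSq Hhat X₀) ∧
      (∀ k ∈ K, ‖k‖ ≤ μ - η → z₀ + k ∈ rowHull V) ∧
      ∃ N : ℝ, 0 ≤ N ∧ N * (μ - η) ≤ η ∧
        ∀ l, ‖Hhat l - V l‖ ≤ η * (1 + N) + N * ‖V l - z₀‖ := by
  set V : Fin r → EuclideanSpace ℝ (Fin d) := fun l => z₀ + K.starProjection (Hhat l - z₀) with hV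
  have hVz : ∀ l, V l - z₀ = K.starProjection (Hhat l - z₀) := fun l => add_sub_cancel_left _ _
  have hVK : ∀ l, V l - z₀ ∈ K := fun l => by
    rw [hVz]
    exact K.starProjection_apply_mem _
  have hdecomp : ∀ x, x - z₀ ∈ K → ∀ p ∈ stdSimplex ℝ (Fin r),
      ∑ l, p l • V l - x = K.starProjection (∑ l, p l • Hhat l - x) := by
    intro x hx p hp
    have h1 : ∑ l, p l • Hhat l - x = ∑ l, p l • (Hhat l - z₀) - (x - z₀) := by
      simp [smul_sub, Finset.sum_sub_distrib, ← Finset.sum_smul, hp.2]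
    rw [h1, map_sub, map_sum, Submodule.starProjection_eq_self_iff.2 hx]
    simp only [map_smul, ← hVz]
    simp [smul_sub, Finset.sum_sub_distrib, ← Finset.sum_smul, hp.2]
  have hnear' : ∀ x, x - z₀ ∈ K → ∀ p ∈ stdSimplex ℝ (Fin r), ‖x - ∑ l, p l • Hhat l‖ ≤ η →
      ‖∑ l, p l • V l - x‖ ≤ η ∧ ‖∑ l, p l • (Hhat l - V l)‖ ≤ η := by
    intro x hx p hp hxp
    rw [norm_sub_rev] at hxp
    refine ⟨?_, ?_⟩
    · rw [hdecomp x hx p hp]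
      exact (K.norm_starProjection_apply_le _).trans hxp
    -- As `x` lies in `z₀ + K`, the combined displacements are exactly the component of the error
    -- orthogonal to `K`.
    · have h1 : ∑ l, p l • (Hhat l - V l) = Kᗮ.starProjection (∑ l, p l • Hhat l - x) := by
        rw [Submodule.starProjection_orthogonal_val, ← hdecomp x hx p hp]
        simp only [smul_sub, Finset.sum_sub_distrib]
        abel
      rw [h1]
      exact (Kᗮ.norm_starProjection_apply_le _).trans hxp
  have hXV : ∀ i, ∃ y ∈ rowHull V, ‖X₀ i - y‖ ≤ η := by
    intro i
    obtain ⟨y, hy, hyn⟩ := hnear i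
    obtain ⟨p, hp, rfl⟩ := mem_rowHull_iff.1 hy
    refine ⟨_, mem_rowHull_iff.2 ⟨p, hp, rfl⟩, ?_⟩
    rw [norm_sub_rev]
    exact (hnear' _ (hXK i) p hp hyn).1
  have hVball : ∀ k ∈ K, ‖k‖ ≤ μ - η → z₀ + k ∈ rowHull V := by
    intro k hk hkn
    refine add_mem_of_forall_exists_near (K := K) (convex_rowHull V) (isCompact_rowHull V)
      (fun c hc => sub_mem_of_mem_rowHull hVK hc) (hη.trans hημ.le) (fun k hk hkn => ?_) hk hkn
    exact forall_rowHull_exists_near (convex_rowHull V) hXV (hball k hk hkn)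
  refine ⟨V, hVK, hXV, ?_, hVball, ?_⟩
  · obtain ⟨P, hP, hPH⟩ := exists_sqrt_sumDistSq_eq Hhat X₀
    rw [hPH]
    refine (sqrt_sumDistSq_le hP).trans (frobNorm_mono fun l => ?_)
    have hPK : P l - z₀ ∈ K := sub_mem_of_mem_rowHull hXK (hP l)
    have h2 : (V - P) l = K.starProjection ((Hhat - P) l) := by
      have h3 : (Hhat - P) l = (Hhat l - z₀) - (P l - z₀) := by simp
      rw [h3, map_sub, Submodule.starProjection_eq_self_iff.2 hPK, ← hVz]
      simp
    rw [h2]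
    exact K.norm_starProjection_apply_le _
  · refine exists_slope_bound hK hVK hη hημ hVball fun k hk hkn => ?_
    obtain ⟨y, hy, hyn⟩ := forall_rowHull_exists_near (convex_rowHull Hhat) hnear (hball k hk hkn)
    obtain ⟨p, hp, rfl⟩ := mem_rowHull_iff.1 hy
    exact ⟨p, hp, hnear' _ (by simpa using hk) p hp hyn⟩

/-- The error bound obtained by expanding a projected estimator `V` about the centre of a relative
ball of radius `ρ` in its convex hull; `a` and `b` are the distances from the expanded simplex to
that of `H₀` and back. -/
theorem exists_selection_bound [NeZero n] (hr : 2 ≤ r) {α μ δ : ℝ}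
    {X₀ : Fin n → EuclideanSpace ℝ (Fin d)} {H₀ V Hhat : Fin r → EuclideanSpace ℝ (Fin d)}
    (hH₀ : LinearIndependent ℝ H₀) (hX₀ : ∀ i, X₀ i ∈ rowHull H₀)
    (huniq : IsUniqueWith α X₀ H₀) (hμ : 0 < μ) (hδ : 0 ≤ δ)
    (hδμ : 60 * δ ≤ μ) (hμD : 2 * μ ≤ √2 * sigmaMax H₀) {z₀ : EuclideanSpace ℝ (Fin d)}
    (hz₀ : z₀ ∈ rowHull H₀) (hVK : ∀ l, V l - z₀ ∈ vectorSpan ℝ (range H₀))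
    (hXV : ∀ i, ∃ y ∈ rowHull V, ‖X₀ i - y‖ ≤ 2 * δ)
    (hVX : √(sumDistSq V X₀) ≤ √(sumDistSq H₀ X₀) + √r * (2 * δ)) {N : ℝ} (hN0 : 0 ≤ N)
    (hN : N * (μ - 2 * δ) ≤ 2 * δ)
    (hNV : ∀ l, ‖Hhat l - V l‖ ≤ 2 * δ * (1 + N) + N * ‖V l - z₀‖)
    {z : EuclideanSpace ℝ (Fin d)} {ρ : ℝ} (hz : z ∈ rowHull H₀) (hρ : 9 / 10 * μ ≤ ρ)
    (hball : ∀ k ∈ vectorSpan ℝ (range H₀), ‖k‖ ≤ ρ → z + k ∈ rowHull V) :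
    ∃ (f : Fin r → Fin r) (a b : ℝ), 0 ≤ a ∧ 0 ≤ b ∧
      α * (a + b) ≤ √r * (2 * δ) + 2 * δ / ρ * (121 / 60 * (√r * (√2 * sigmaMax H₀))) ∧
      (∀ x ∈ rowHull H₀, ∃ y ∈ rowHull V,
        ‖x - y‖ ≤ b + 2 * δ / ρ * (121 / 60 * (√r * (√2 * sigmaMax H₀)))) ∧
      frobNorm (H₀ - Hhat ∘ f) ≤ 11 / 10 * (√2 * condNumber H₀ * (√r * a + b) + √r * a) +
        6 * (√r * (√2 * sigmaMax H₀) * (δ / μ)) ∧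
      (r * (a + b) ≤ sigmaMin H₀ →
        frobNorm (H₀ - Hhat ∘ f) ≤ 11 / 10 * (√2 * condNumber H₀ * (√2 * a + b) + √r * a) +
          6 * (√r * (√2 * sigmaMax H₀) * (δ / μ))) := by
  have hr0 : r ≠ 0 := by omega
  have : NeZero r := ⟨hr0⟩
  set D := √2 * sigmaMax H₀ with hD
  have hD0 : 0 ≤ D := by linarith
  have hρ0 : 0 < ρ := by linarith
  set ε := 2 * δ / ρ with hε
  have hε0 : 0 ≤ ε := by positivity
  have hdiam : ∀ {x y}, x ∈ rowHull H₀ → y ∈ rowHull H₀ → ‖x - y‖ ≤ D := fun hx hy =>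
    norm_sub_le_of_mem_rowHull hx hy
  have hVz : ∀ l, V l - z ∈ vectorSpan ℝ (range H₀) := by
    intro l
    have := Submodule.add_mem _ (hVK l) (sub_mem_vectorSpan_of_mem_rowHull hz₀ hz)
    rwa [sub_add_sub_cancel] at this
  have hX₀hull := rowHull_subset (convex_rowHull H₀) hX₀
  -- One `√r * D` for the objective at `H₀`, one for the spread of conv(H₀), and `1 / 60` for the
  -- noise, since `2 * δ ≤ μ / 30 ≤ D / 60`.
  have hB : frobNorm (fun l => V l - z) ≤ 121 / 60 * (√r * D) := by
    obtain ⟨P, hP, hPV⟩ := exists_sqrt_sumDistSq_eq V X₀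
    have h1 : frobNorm (fun l => V l - z) ≤ frobNorm (V - P) + frobNorm (fun l => P l - z) :=
      frobNorm_le_add fun l => norm_sub_le_norm_sub_add_norm_sub (V l) (P l) z
    have h2 : frobNorm (fun l => P l - z) ≤ √r * D :=
      frobNorm_le_of_forall_le (fun l => hdiam (hX₀hull (hP l)) hz) hD0
    have h3 : √(sumDistSq H₀ X₀) ≤ √r * D :=
      (sqrt_sumDistSq_le (P := fun _ => X₀ 0) fun _ => mem_rowHull_self X₀ 0).trans
        (frobNorm_le_of_forall_le (fun l => hdiam (mem_rowHull_self H₀ l) (hX₀ 0)) hD0)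
    have h4 : √r * (2 * δ) ≤ √r * (1 / 60 * D) :=
      mul_le_mul_of_nonneg_left (by linarith) (Real.sqrt_nonneg _)
    linarith
  set H : Fin r → EuclideanSpace ℝ (Fin d) := fun l => z + (1 + ε) • (V l - z) with hH
  set a := √(sumDistSq H H₀) with ha
  set b := √(sumDistSq H₀ H) with hb
  have hεB := mul_le_mul_of_nonneg_left hB hε0
  have hround := huniq.bound_of_near hρ0 (by linarith) hball hXV
    (fun i => sub_mem_vectorSpan_of_mem_rowHull (hX₀ i) hz) hVz (H := H) fun l => rfl
  have hHV : ∀ g : Fin r → Fin r, frobNorm (H ∘ g - V ∘ g) = ε * frobNorm (fun l => V (g l) - z) :=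
      by
    intro g
    rw [← frobNorm_smul_of_nonneg hε0]
    congr 1
    ext1 l
    simp only [hH, Pi.sub_apply, Function.comp_apply, Pi.smul_apply, add_smul, one_smul]
    abel
  obtain ⟨f, hf1, hf2⟩ := exists_vertex_selection hr0 hH₀ H rfl rfl
  have hfinal : frobNorm (H₀ - Hhat ∘ f) ≤
      11 / 10 * frobNorm (H₀ - H ∘ f) + 6 * (√r * D * (δ / μ)) := by
    set G := frobNorm (H₀ - H ∘ f) with hG
    set G' := frobNorm (H₀ - V ∘ f) with hG'
    have hG0 : 0 ≤ G := frobNorm_nonneg _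
    set θ := δ / μ with hθ
    have hθ0 : 0 ≤ θ := by positivity
    have hθ1 : θ ≤ 1 / 60 := by rw [hθ, div_le_iff₀ hμ]; linarith
    have hδθ : δ = θ * μ := by rw [hθ, div_mul_cancel₀ _ hμ.ne']
    have hRD : 0 ≤ √r * D := by positivity
    have hspread : ∀ x ∈ rowHull H₀, frobNorm (fun l => H₀ l - x) ≤ √r * D := fun x hx =>
      frobNorm_le_of_forall_le (fun l => hdiam (mem_rowHull_self H₀ l) hx) hD0
    have hεθ : ε ≤ 20 / 9 * θ := by
      rw [hε, div_le_iff₀ hρ0]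
      calc 2 * δ = 20 / 9 * θ * (9 / 10 * μ) := by rw [hδθ]; ring
        _ ≤ _ := by gcongr
    have hNθ : N ≤ 60 / 29 * θ := by
      have h1 : N * (29 / 30 * μ) ≤ 60 / 29 * θ * (29 / 30 * μ) := by
        calc N * (29 / 30 * μ) ≤ N * (μ - 2 * δ) := by gcongr; linarith
          _ ≤ 2 * δ := hN
          _ = _ := by rw [hδθ]; ring
      exact le_of_mul_le_mul_right h1 (by positivity)
    -- With repetitions in `f`, `hB` does not bound the selected rows; their distance to `z` is
    -- measured through `H₀` instead.
    have h1 : G' ≤ G + ε * (G + √r * D) := by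
      have h2 : G' ≤ G + frobNorm (H ∘ f - V ∘ f) := frobNorm_sub_le_add _ _ _
      have h3 : frobNorm (H ∘ f - V ∘ f) ≤ ε * frobNorm (fun l => H (f l) - z) := by
        rw [hHV]
        refine mul_le_mul_of_nonneg_left (frobNorm_mono fun l => ?_) hε0
        have h4 : H (f l) - z = (1 + ε) • (V (f l) - z) := add_sub_cancel_left _ _
        rw [h4, norm_smul, Real.norm_of_nonneg (by positivity)]
        exact le_mul_of_one_le_left (norm_nonneg _) (by linarith)
      have h5 : frobNorm (fun l => H (f l) - z) ≤ G + √r * D := by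
        refine le_trans ?_ (add_le_add_right (hspread z hz) G)
        refine frobNorm_le_add fun l => ?_
        rw [Pi.sub_apply, Function.comp_apply, ← norm_sub_rev (H (f l))]
        exact norm_sub_le_norm_sub_add_norm_sub _ _ _
      have h6 := mul_le_mul_of_nonneg_left h5 hε0
      linarith
    have h2 : frobNorm (H₀ - Hhat ∘ f) ≤
        G' + (√r * (2 * δ * (1 + N)) + N * (G' + √r * D)) := by
      have h3 : frobNorm (H₀ - Hhat ∘ f) ≤ G' + frobNorm (V ∘ f - Hhat ∘ f) :=
        frobNorm_sub_le_add _ _ _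
      have h4 : frobNorm (V ∘ f - Hhat ∘ f) ≤ frobNorm (fun _ : Fin r => 2 * δ * (1 + N)) +
          frobNorm (N • fun l => V (f l) - z₀) := by
        refine frobNorm_le_add fun l => ?_
        rw [Pi.sub_apply, norm_sub_rev, Pi.smul_apply, norm_smul, Real.norm_of_nonneg hN0,
          Real.norm_of_nonneg (by positivity)]
        exact hNV (f l)
      rw [frobNorm_const, Real.norm_of_nonneg (by positivity), frobNorm_smul_of_nonneg hN0] at h4
      have h5 : frobNorm (fun l => V (f l) - z₀) ≤ G' + √r * D := by
        refine le_trans ?_ (add_le_add_right (hspread z₀ hz₀) G')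
        refine frobNorm_le_add fun l => ?_
        rw [Pi.sub_apply, Function.comp_apply, ← norm_sub_rev (V (f l))]
        exact norm_sub_le_norm_sub_add_norm_sub _ _ _
      have h6 := mul_le_mul_of_nonneg_left h5 hN0
      linarith
    have h3 : √r * (2 * δ) ≤ √r * D * θ := by
      rw [mul_assoc]
      refine mul_le_mul_of_nonneg_left ?_ (Real.sqrt_nonneg _)
      rw [hδθ]
      nlinarith
    have hG'0 : 0 ≤ G' := frobNorm_nonneg _
    have hN1 : N ≤ 1 / 29 := by linarith
    have hε1 : ε ≤ 1 / 27 := by linarith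
    have h4 : ε * G ≤ 1 / 27 * G := by gcongr
    have h5 : ε * (√r * D) ≤ 20 / 9 * θ * (√r * D) := by gcongr
    have h6 : N * G' ≤ 1 / 29 * G' := by gcongr
    have h7 : N * (√r * D) ≤ 60 / 29 * θ * (√r * D) := by gcongr
    have h8 : N * (√r * (2 * δ)) ≤ 1 / 29 * (√r * (2 * δ)) := by gcongr
    have h9 : 0 ≤ √r * D * θ := by positivity
    nlinarith
  refine ⟨f, a, b, Real.sqrt_nonneg _, Real.sqrt_nonneg _, by linarith, ?_, by linarith,
    fun hs => by linarith [hf2 hs]⟩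
  -- From conv(H₀) to conv(H) costs `b`; undoing the expansion moves each row by at most the second
  -- term.
  intro x hx
  obtain ⟨y, hy, hxy⟩ := exists_near_of_sqrt_sumDistSq_le hb.ge hx
  obtain ⟨y', hy', hyy'⟩ := forall_rowHull_exists_near (convex_rowHull V) (fun l => ⟨V l,
    mem_rowHull_self V l, ((norm_le_frobNorm (H ∘ id - V ∘ id) l).trans_eq (hHV id)).trans hεB⟩) hy
  exact ⟨y', hy', (norm_sub_le_norm_sub_add_norm_sub x y y').trans (add_le_add hxy hyy')⟩

/-! ### Numerical estimates -/

theorem rpow_half_eq_sqrt_pow (x : ℝ) (hx : 0 ≤ x) (m : ℕ) :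
    x ^ ((m : ℝ) / 2) = √x ^ m := by
  rw [Real.sqrt_eq_rpow, ← Real.rpow_natCast, ← Real.rpow_mul hx]
  congr 1
  ring

theorem sqrt_two_le : √2 ≤ 3 / 2 := Real.sqrt_le_iff.2 ⟨by norm_num, by norm_num⟩

/-- The numerical conclusion of the first bound. Here `R = √r`. -/
theorem le_of_coarse_selection_bound {R S κ M μ α δ a b x : ℝ} (hR : 2 ≤ R ^ 2) (hR0 : 0 ≤ R)
    (hS : 0 ≤ S)
    (hM : 1 ≤ M) (hκ0 : 0 ≤ κ) (hκ : κ ≤ R * M) (hμ : 0 < μ) (hα : 0 < α) (hα1 : α ≤ 1)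
    (hδ : 0 ≤ δ) (ha : 0 ≤ a) (hb : 0 ≤ b)
    (hab : α * (a + b) ≤ 11 / 2 * (R * (√2 * S) * (δ / μ)))
    (hx : x ≤ 11 / 10 * (√2 * κ * (R * a + b) + R * a) + 6 * (R * (√2 * S) * (δ / μ))) :
    x ≤ 120 * (S / μ) * M * R ^ 5 / α * δ := by
  have hR1 : 1 ≤ R := by nlinarith
  have h2 := sqrt_two_le
  set Q := R * (√2 * S) * (δ / μ) with hQ
  have hQ0 : 0 ≤ Q := by positivity
  have hQS : Q ≤ 3 / 2 * (R * (S / μ) * δ) := by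
    calc Q = √2 * (R * (S / μ) * δ) := by rw [hQ]; ring
      _ ≤ _ := by gcongr
  have h3 : √2 * κ * (R * a + b) ≤ 3 / 2 * (R * M) * (R * (a + b)) := by
    have h4 : R * a + b ≤ R * (a + b) := by nlinarith
    gcongr
  have h4 : R * a ≤ R * M * (R * (a + b)) := by
    have : 1 * (R * a) ≤ R * M * (R * (a + b)) := by
      gcongr
      · nlinarith
      · linarith
    linarith
  have h5 : x ≤ 11 / 4 * (R ^ 2 * M) * (a + b) + 6 * Q := by nlinarith
  have h6 : a + b ≤ 11 / 2 * Q / α := by rw [le_div_iff₀ hα]; linarith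
  have h7 : Q ≤ R ^ 2 * M * (Q / α) := by
    have h8 : Q ≤ Q / α := by rw [le_div_iff₀ hα]; nlinarith
    have h9 : 1 ≤ R ^ 2 * M := by nlinarith
    nlinarith [mul_nonneg (sub_nonneg.2 h9) (hQ0.trans h8)]
  have h8 : x ≤ 22 * (R ^ 2 * M * (Q / α)) := by
    have h9 : 11 / 4 * (R ^ 2 * M) * (a + b) ≤ 11 / 4 * (R ^ 2 * M) * (11 / 2 * Q / α) := by
      gcongr
    have h10 : 11 / 4 * (R ^ 2 * M) * (11 / 2 * Q / α) = 121 / 8 * (R ^ 2 * M * (Q / α)) := by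
      ring
    have h11 : 0 ≤ R ^ 2 * M * (Q / α) := by positivity
    linarith
  calc x ≤ 22 * (R ^ 2 * M * (Q / α)) := h8
    _ ≤ 22 * (R ^ 2 * M * (3 / 2 * (R * (S / μ) * δ) / α)) := by gcongr
    _ = 33 * (S / μ) * M * R ^ 3 / α * δ := by ring
    _ ≤ 120 * (S / μ) * M * R ^ 5 / α * δ := by gcongr <;> norm_num

/-- The numerical conclusion of the second bound. Here `R = √r`. -/
theorem le_of_fine_selection_bound {R S κ M m μ α δ a b x : ℝ} (hR : 2 ≤ R ^ 2) (hR0 : 0 ≤ R)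
    (hS : 0 ≤ S)
    (hM : 1 ≤ M) (hκ0 : 0 ≤ κ) (hκ : κ ≤ R * M) (hm1 : κ ≤ m) (hm2 : S / R ^ 2 / (μ * R) ≤ m)
    (hμ : 0 < μ) (hα : 0 < α) (hα1 : α ≤ 1) (hδ : 0 ≤ δ) (ha : 0 ≤ a) (hb : 0 ≤ b)
    (hab : α * (a + b) ≤ 33 / 4 * (R ^ 3 * κ * δ))
    (hx : x ≤ 11 / 10 * (√2 * κ * (√2 * a + b) + R * a) + 6 * (R * (√2 * S) * (δ / μ))) :
    x ≤ 120 * m * M * R ^ 4 / α * δ := by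
  have hR1 : 1 ≤ R := by nlinarith
  have h2 := sqrt_two_le
  have hm0 : 0 ≤ m := hκ0.trans hm1
  have h3 : √2 * κ * (√2 * a + b) ≤ 3 / 2 * (R * M) * (3 / 2 * (a + b)) := by
    have h4 : √2 * a + b ≤ 3 / 2 * (a + b) := by nlinarith
    gcongr
  have h4 : R * a ≤ R * M * (a + b) := by
    have : R * 1 * a ≤ R * M * (a + b) := by
      gcongr
      linarith
    linarith
  have h5 : 11 / 10 * (√2 * κ * (√2 * a + b) + R * a) ≤ 18 / 5 * (R * M * (a + b)) := by
    have : 0 ≤ R * M * (a + b) := by positivity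
    nlinarith
  have h6 : a + b ≤ 33 / 4 * (R ^ 3 * m * δ) / α := by
    rw [le_div_iff₀ hα]
    calc (a + b) * α = α * (a + b) := mul_comm _ _
      _ ≤ 33 / 4 * (R ^ 3 * κ * δ) := hab
      _ ≤ _ := by gcongr
  have h7 : 18 / 5 * (R * M * (a + b)) ≤ 30 * (m * M * R ^ 4 / α * δ) := by
    calc _ ≤ 18 / 5 * (R * M * (33 / 4 * (R ^ 3 * m * δ) / α)) := by gcongr
      _ = 297 / 10 * (m * M * R ^ 4 / α * δ) := by ring
      _ ≤ _ := by gcongr; norm_num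
  have h8 : R * (√2 * S) * (δ / μ) ≤ 3 / 2 * (m * M * R ^ 4 / α * δ) := by
    have hR' : 0 < R := by linarith
    calc R * (√2 * S) * (δ / μ) ≤ R * (3 / 2 * S) * (δ / μ) := by gcongr
      _ = 3 / 2 * (S / R ^ 2 / (μ * R) * 1 * R ^ 4 / 1 * δ) := by field_simp
      _ ≤ _ := by gcongr
  have h9 : 0 ≤ m * M * R ^ 4 / α * δ := by positivity
  calc x ≤ 39 * (m * M * R ^ 4 / α * δ) := by linarith
    _ ≤ 120 * (m * M * R ^ 4 / α * δ) := by gcongr; norm_num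
    _ = _ := by ring

end Archetypes

/-! ### The two error bounds -/

theorem theorem2 {n r d : ℕ} (hr : 2 ≤ r)
    (W₀ : Matrix (Fin n) (Fin r) ℝ) (hW₀ : ∀ i, W₀ i ∈ stdSimplex ℝ (Fin r))
    (H₀ : Fin r → EuclideanSpace ℝ (Fin d)) (hH₀ : LinearIndependent ℝ H₀)
    (Z X : Fin n → EuclideanSpace ℝ (Fin d))
    (hX : ∀ i, X i = Archetypes.weightedRows W₀ H₀ i + Z i)
    (α : ℝ) (hα : 0 < α)
    (huniq : Archetypes.IsUniqueWith α (Archetypes.weightedRows W₀ H₀) H₀)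
    (μ : ℝ) (hμ : 0 < μ) (z₀ : EuclideanSpace ℝ (Fin d))
    (hball : Archetypes.ContainsBall (r - 1) (Archetypes.weightedRows W₀ H₀) z₀ μ)
    (Hhat : Fin r → EuclideanSpace ℝ (Fin d))
    (hHhat : Archetypes.IsEstimator (Archetypes.maxRowNorm Z) X Hhat) :
    (Archetypes.maxRowNorm Z ≤ α * μ / (30 * (r : ℝ) ^ (3 / 2 : ℝ)) →
      Archetypes.archetypeLoss H₀ Hhat ≤
        Archetypes.coeffOne H₀ μ ^ 2 * (r : ℝ) ^ 5 / α ^ 2 * Archetypes.maxRowNorm Z ^ 2) ∧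
    (Archetypes.maxRowNorm Z ≤
        α * μ / (330 * Archetypes.condNumber H₀ * (r : ℝ) ^ (5 / 2 : ℝ)) →
      Archetypes.archetypeLoss H₀ Hhat ≤
        Archetypes.coeffTwo H₀ z₀ μ ^ 2 * (r : ℝ) ^ 4 / α ^ 2 * Archetypes.maxRowNorm Z ^ 2) := by
  open Archetypes in
  have hr0 : r ≠ 0 := by omega
  have : NeZero r := ⟨hr0⟩
  set X₀ := weightedRows W₀ H₀ with hX₀def
  set δ := maxRowNorm Z with hδdef
  have hX₀ : ∀ i, X₀ i ∈ rowHull H₀ := fun i => mem_rowHull_iff.2 ⟨W₀ i, hW₀ i, rfl⟩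
  have hX₀hull := rowHull_subset (convex_rowHull H₀) hX₀
  have hballK : ∀ k ∈ vectorSpan ℝ (range H₀), ‖k‖ ≤ μ → z₀ + k ∈ rowHull X₀ := fun k hk hkn =>
    hball.add_mem hμ hr0 hH₀ hX₀ hk hkn
  have hz₀X : z₀ ∈ rowHull X₀ := by
    simpa using hballK 0 (Submodule.zero_mem _) (by simpa using hμ.le)
  have hz₀ := hX₀hull hz₀X
  have hn : NeZero n := by
    refine ⟨fun hn => ?_⟩
    subst hn
    obtain ⟨p, hp, -⟩ := mem_rowHull_iff.1 hz₀X
    simpa using hp.2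
  have hα1 : α ≤ 1 := huniq.le_one hα hr hH₀ hX₀
  have hZδ : ∀ i, ‖Z i‖ ≤ δ := fun i => le_ciSup (f := fun i => ‖Z i‖) (finite_range _).bddAbove i
  have hδ0 : 0 ≤ δ := (norm_nonneg _).trans (hZδ 0)
  have hXX₀ : ∀ i, ‖X i - X₀ i‖ ≤ δ := fun i => by
    rw [hX i, add_sub_cancel_left]
    exact hZδ i
  set S := sigmaMax H₀ with hS
  set s := sigmaMin H₀ with hs
  have hs0 : 0 < s := sigmaMin_pos hr0 hH₀
  have hsS : s ≤ S := sigmaMin_le_sigmaMax hr0 hH₀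
  have hS0 : 0 < S := hs0.trans_le hsS
  -- A ball inside conv(H₀) has diameter at most that of conv(H₀); `r ≥ 2` supplies a nonzero
  -- direction.
  have hμD : 2 * μ ≤ √2 * S := by
    set k := H₀ ⟨0, by omega⟩ - H₀ ⟨1, by omega⟩ with hk
    have hkK : k ∈ vectorSpan ℝ (range H₀) :=
      sub_mem_vectorSpan_of_mem_rowHull (mem_rowHull_self _ _) (mem_rowHull_self _ _)
    have hk0 : 0 < ‖k‖ := by
      refine norm_pos_iff.2 (sub_ne_zero.2 fun h => ?_)
      simpa using hH₀.injective h
    have hkn : ‖(μ / ‖k‖) • k‖ = μ := by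
      rw [norm_smul, norm_div, norm_norm, div_mul_cancel₀ _ hk0.ne', Real.norm_of_nonneg hμ.le]
    have hkK' := Submodule.smul_mem _ (μ / ‖k‖) hkK
    have h := norm_sub_le_of_mem_rowHull (hX₀hull (hballK _ hkK' hkn.le))
      (hX₀hull (hballK _ (Submodule.neg_mem _ hkK') (by rw [norm_neg, hkn])))
    rwa [add_sub_add_left_eq_sub, sub_neg_eq_add, ← two_smul ℝ, norm_smul, hkn,
      Real.norm_two] at h
  have hnear : ∀ i, ∃ y ∈ rowHull Hhat, ‖X₀ i - y‖ ≤ 2 * δ := by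
    intro i
    obtain ⟨y, hy, hyd⟩ := exists_distSq_eq Hhat (X i)
    have h1 : ‖X i - y‖ ≤ δ := le_of_sq_le_sq (hyd ▸ hHhat.1 i) hδ0
    refine ⟨y, hy, ?_⟩
    have h2 := norm_sub_le_norm_sub_add_norm_sub (X₀ i) (X i) y
    have h3 := hXX₀ i
    rw [norm_sub_rev] at h3
    linarith
  -- `H₀` is feasible, so minimality compares it with `Hhat`; exchanging `X` and `X₀` on each side
  -- costs `√r * δ`.
  have hobj : √(sumDistSq Hhat X₀) ≤ √(sumDistSq H₀ X₀) + √r * (2 * δ) := by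
    have h1 : √(sumDistSq Hhat X) ≤ √(sumDistSq H₀ X) := by
      refine Real.sqrt_le_sqrt (hHhat.2 H₀ fun i => (distSq_le _ (hX₀ i)).trans ?_)
      exact pow_le_pow_left₀ (norm_nonneg _) (hXX₀ i) 2
    have h2 : √(sumDistSq Hhat X₀) ≤ √(sumDistSq Hhat X) + √r * δ :=
      sqrt_sumDistSq_le_of_near _ hδ0 fun x hx =>
        forall_rowHull_exists_near (convex_rowHull _)
          (fun i => ⟨X₀ i, mem_rowHull_self _ i, hXX₀ i⟩) hx
    have h3 : √(sumDistSq H₀ X) ≤ √(sumDistSq H₀ X₀) + √r * δ :=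
      sqrt_sumDistSq_le_of_near _ hδ0 fun x hx =>
        forall_rowHull_exists_near (convex_rowHull _)
          (fun i => ⟨X i, mem_rowHull_self _ i, by rw [norm_sub_rev]; exact hXX₀ i⟩) hx
    linarith
  set R := √(r : ℝ) with hR
  have hRsq : R ^ 2 = r := Real.sq_sqrt (Nat.cast_nonneg r)
  have hR0 : 0 ≤ R := Real.sqrt_nonneg _
  have hR2 : 2 ≤ R ^ 2 := by rw [hRsq]; exact_mod_cast hr
  have hR1 : 1 ≤ R := by nlinarith
  set κ := condNumber H₀ with hκ
  have hκS : κ * s = S := div_mul_cancel₀ _ hs0.ne'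
  have hκ1 : 1 ≤ κ := (one_le_div hs0).2 hsS
  set M := max 1 (κ / R) with hM
  have hM1 : 1 ≤ M := le_max_left _ _
  -- This is why the maximum appears: both `κ` and `R` are at most `R * M`.
  have hκM : κ ≤ R * M := by
    rw [mul_comm, ← div_le_iff₀ (by linarith)]
    exact le_max_right _ _
  set Q := R * (√2 * S) * (δ / μ) with hQ
  have hQ0 : 0 ≤ Q := by positivity
  have hδQ : R * (2 * δ) ≤ Q := by
    calc R * (2 * δ) = R * (2 * μ) * (δ / μ) := by field_simp
      _ ≤ Q := by rw [hQ]; gcongr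
  have hexpand : ∀ ρ, 9 / 10 * μ ≤ ρ → 2 * δ / ρ * (121 / 60 * (R * (√2 * S))) ≤ 9 / 2 * Q := by
    intro ρ hρ
    calc _ ≤ 2 * δ / (9 / 10 * μ) * (121 / 60 * (R * (√2 * S))) := by gcongr
      _ = 121 / 27 * Q := by rw [hQ]; field_simp; ring
      _ ≤ 9 / 2 * Q := mul_le_mul_of_nonneg_right (by norm_num) hQ0
  have hloss : ∀ (f : Fin r → Fin r) (c : ℝ), frobNorm (H₀ - Hhat ∘ f) ≤ c →
      archetypeLoss H₀ Hhat ≤ c ^ 2 := fun f c hc =>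
    (archetypeLoss_le H₀ Hhat f).trans (pow_le_pow_left₀ (frobNorm_nonneg _) hc 2)
  have hproj : 60 * δ ≤ μ → _ := fun hδμ => exists_projection
    (finrank_vectorSpan_add_one hr0 hH₀) (show 0 ≤ 2 * δ by positivity)
    (show 2 * δ < μ by linarith) hballK
    (fun i => sub_mem_vectorSpan_of_mem_rowHull (hX₀ i) hz₀) hnear
  refine ⟨fun hsmall => ?_, fun hsmall => ?_⟩
  · have h32 : (r : ℝ) ^ (3 / 2 : ℝ) = R ^ 3 := by
      simpa using rpow_half_eq_sqrt_pow r (Nat.cast_nonneg r) 3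
    rw [h32, le_div_iff₀ (by positivity)] at hsmall
    have hδμ : 60 * δ ≤ μ := by
      have h1 : 2 ≤ R ^ 3 := by nlinarith
      have h2 : α * μ ≤ 1 * μ := by gcongr
      nlinarith
    obtain ⟨V, hVK, hXV, hVX, hVball, N, hN0, hN, hNV⟩ := hproj hδμ
    have hρ : 9 / 10 * μ ≤ μ - 2 * δ := by linarith
    obtain ⟨f, a, b, ha, hb, hab, -, hf, -⟩ := exists_selection_bound hr hH₀ hX₀ huniq hμ hδ0 hδμ
      hμD hz₀ hVK hXV (hVX.trans hobj) hN0 hN hNV hz₀ hρ hVball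
    have hfin := le_of_coarse_selection_bound hR2 hR0 hS0.le hM1 (by linarith) hκM hμ hα hα1 hδ0 ha hb
      (by linarith [hexpand _ hρ]) hf
    refine (hloss f _ hfin).trans_eq ?_
    rw [coeffOne, ← hR, show (r : ℝ) ^ 5 = R ^ 10 by rw [← hRsq]; ring]
    ring
  · have h52 : (r : ℝ) ^ (5 / 2 : ℝ) = R ^ 5 := by
      simpa using rpow_half_eq_sqrt_pow r (Nat.cast_nonneg r) 5
    rw [h52, le_div_iff₀ (by positivity)] at hsmall
    have hδμ : 60 * δ ≤ μ := by
      have h1 : 1 ≤ R ^ 5 := one_le_pow₀ hR1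
      have h2 : α * μ ≤ 1 * μ := by gcongr
      have h3 : δ * (330 * 1 * 1) ≤ δ * (330 * κ * R ^ 5) := by gcongr
      linarith
    have hQs : Q ≤ 1 / 200 * (α * (s / R ^ 4)) := by
      calc Q = √2 * (s / R ^ 4) * (δ * (330 * κ * R ^ 5)) / (330 * μ) := by
            rw [hQ, ← hκS]
            field_simp
        _ ≤ 3 / 2 * (s / R ^ 4) * (α * μ) / (330 * μ) := by
            have := sqrt_two_le
            gcongr
        _ = 1 / 220 * (α * (s / R ^ 4)) := by field_simp; ring
        _ ≤ _ := by gcongr; norm_num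
    have hR4 : s / R ^ 4 ≤ 1 / 2 * (s / R ^ 2) := by
      rw [show s / R ^ 4 = s / R ^ 2 * (1 / R ^ 2) by field_simp, mul_comm]
      gcongr
    -- Here `11 / 2 = 1 + 9 / 2`: the objective gap plus the expansion cost from `hexpand`.
    have hround : ∀ a b : ℝ, α * (a + b) ≤ 11 / 2 * Q → a + b ≤ 11 / 400 * (s / R ^ 4) := by
      intro a b hab
      refine le_of_mul_le_mul_left ?_ hα
      linarith
    have hround' : ∀ a b : ℝ, α * (a + b) ≤ 11 / 2 * Q → r * (a + b) ≤ s := by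
      intro a b hab
      calc r * (a + b) ≤ R ^ 2 * (s / R ^ 2) := by
            rw [← hRsq]
            gcongr
            have := hround a b hab
            have : 0 ≤ s / R ^ 2 := by positivity
            linarith
        _ = s := by field_simp
    obtain ⟨V, hVK, hXV, hVX, hVball, N, hN0, hN, hNV⟩ := hproj hδμ
    have hρ : 9 / 10 * μ ≤ μ - 2 * δ := by linarith
    obtain ⟨f, a, b, ha, hb, hab, hHV, -, hf⟩ := exists_selection_bound hr hH₀ hX₀ huniq hμ hδ0 hδμ
      hμD hz₀ hVK hXV (hVX.trans hobj) hN0 hN hNV hz₀ hρ hVball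
    -- This part of the coefficient pays for returning from `V` to `Hhat`, where `δ / μ` persists
    -- even after recentring.
    have hm2 : S / R ^ 2 / (μ * R) ≤ max κ ((S / r + ‖z₀‖) / (μ * R)) := by
      refine le_trans ?_ (le_max_right _ _)
      rw [hRsq]
      gcongr
      exact le_add_of_nonneg_right (norm_nonneg _)
    have hfinish : ∀ (f : Fin r → Fin r) (a b : ℝ), 0 ≤ a → 0 ≤ b →
        α * (a + b) ≤ 33 / 4 * (R ^ 3 * κ * δ) →
        frobNorm (H₀ - Hhat ∘ f) ≤ 11 / 10 * (√2 * κ * (√2 * a + b) + R * a) + 6 * Q →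
        archetypeLoss H₀ Hhat ≤ coeffTwo H₀ z₀ μ ^ 2 * (r : ℝ) ^ 4 / α ^ 2 * δ ^ 2 := by
      intro f a b ha hb hab hf
      have hfin := le_of_fine_selection_bound hR2 hR0 hS0.le hM1 (by linarith) hκM (le_max_left _ _)
        hm2 hμ hα hα1 hδ0 ha hb hab hf
      refine (hloss f _ hfin).trans_eq ?_
      rw [coeffTwo, ← hR, show (r : ℝ) ^ 4 = R ^ 8 by rw [← hRsq]; ring]
      ring
    have habQ : α * (a + b) ≤ 11 / 2 * Q := by linarith [hexpand _ hρ]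
    -- The larger of the two available balls is used: the given one, or the one about the centroid
    -- of `H₀`.
    rcases le_or_gt (s / R ^ 2) μ with hμs | hμs
    · refine hfinish f a b ha hb (habQ.trans ?_) (hf (hround' a b habQ))
      have h2 := sqrt_two_le
      calc 11 / 2 * Q ≤ 11 / 2 * (R * (3 / 2 * S) * (δ / (s / R ^ 2))) := by rw [hQ]; gcongr
        _ = 33 / 4 * (R ^ 3 * κ * δ) := by rw [← hκS]; field_simp; ring
    · have hρ' : 9 / 10 * μ ≤ 9 / 10 * (s / R ^ 2) := by gcongr
      -- The first pass is used only here: conv(V) comes close enough to conv(H₀) to keep nine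
      -- tenths of the centroid ball.
      have hgap : b + 2 * δ / (μ - 2 * δ) * (121 / 60 * (R * (√2 * S))) ≤ 1 / 10 * (s / R ^ 2) := by
        have h1 := hround a b habQ
        have h2 : Q ≤ 1 / 200 * (1 * (s / R ^ 4)) := hQs.trans (by gcongr)
        have h3 : 0 ≤ s / R ^ 2 := by positivity
        linarith [hexpand _ hρ]
      have hz₁ : ∑ l, (r : ℝ)⁻¹ • H₀ l ∈ rowHull H₀ := centroid_mem_rowHull hr0
      have hVK₁ : ∀ l, V l - ∑ l, (r : ℝ)⁻¹ • H₀ l ∈ vectorSpan ℝ (range H₀) := by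
        intro l
        have := Submodule.add_mem _ (hVK l) (sub_mem_vectorSpan_of_mem_rowHull hz₀ hz₁)
        rwa [sub_add_sub_cancel] at this
      have hball₁ : ∀ k ∈ vectorSpan ℝ (range H₀), ‖k‖ ≤ 9 / 10 * (s / R ^ 2) →
          ∑ l, (r : ℝ)⁻¹ • H₀ l + k ∈ rowHull V := by
        intro k hk hkn
        refine add_mem_of_forall_exists_near (K := vectorSpan ℝ (range H₀)) (ρ := s / R ^ 2)
          (convex_rowHull V) (isCompact_rowHull V) (fun c hc => sub_mem_of_mem_rowHull hVK₁ hc)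
          (by positivity) (fun k hk hkn => ?_) hk
          (show ‖k‖ ≤ s / R ^ 2 - 1 / 10 * (s / R ^ 2) by linarith)
        rw [hRsq] at hkn
        obtain ⟨y, hy, hyn⟩ := hHV _ (centroid_add_mem_rowHull hr0 hH₀ hk hkn)
        exact ⟨y, hy, hyn.trans hgap⟩
      obtain ⟨f, a, b, ha, hb, hab, -, -, hf⟩ := exists_selection_bound hr hH₀ hX₀ huniq hμ hδ0 hδμ
        hμD hz₀ hVK hXV (hVX.trans hobj) hN0 hN hNV hz₁ hρ' hball₁
      refine hfinish f a b ha hb (hab.trans ?_)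
        (hf (hround' a b (by linarith [hexpand _ hρ'])))
      have h2 := sqrt_two_le
      -- Objective gap and expansion cost add up to `1 + 121 / 18`, below the required `33 / 4`.
      have h3 : R * (2 * δ) ≤ R ^ 3 * κ * δ := by
        calc R * (2 * δ) ≤ R * (R ^ 2 * δ) := by gcongr
          _ = R ^ 3 * 1 * δ := by ring
          _ ≤ _ := by gcongr
      have h4 : 2 * δ / (9 / 10 * (s / R ^ 2)) * (121 / 60 * (R * (√2 * S))) ≤
          2 * δ / (9 / 10 * (s / R ^ 2)) * (121 / 60 * (R * (3 / 2 * S))) := by gcongr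
      have h5 : 2 * δ / (9 / 10 * (s / R ^ 2)) * (121 / 60 * (R * (3 / 2 * S))) =
          121 / 18 * (R ^ 3 * κ * δ) := by rw [← hκS]; field_simp; ring
      have h6 : 0 ≤ R ^ 3 * κ * δ := by positivity
      linarith
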